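/- **Setting.** For $i=1,2,\dots$ let $b_i,h_i>0$, $\sigma_{p,i},\sigma_{f,i}>0$, $\theta_i\in\mathbb R$ be fixed sequences, and put $\tilde b_i=b_i/(b_i+h_i)$. For each $n$ let $X_1,\dots,X_n$ be independent with $X_i\sim N(\theta_i,\sigma_{p,i})$ (the second argument is the variance). Write $\phi,\Phi$ for the standard normal density and distribution function, $H_k$ for the probabilists' Hermite polynomials, and $G(w,\beta)=\phi(w)+w\Phi(w)-\beta w$, with $G'=\partial_w G$. **Estimators and loss.** For $\tau\in[0,\infty]$ let $\alpha_i(\tau)=\tau/(\tau+\sigma_{p,i})$, with $\alpha_i(\infty)=1$. The class $\mathcal S$ consists of the predictors $\hat{\mathbf q}(\eta,\tau)=(\hat q_i(\eta,\tau))_{i\le n}$, $\eta\in\mathbb R$, $\tau\in[0,\infty]$, where $$\hat q_i(\eta,\tau)=\alpha_i(\tau)X_i+(1-\alpha_i(\tau))\eta+\sqrt{\sigma_{f,i}+\alpha_i(\tau)\sigma_{p,i}}\;\Phi^{-1}(\tilde b_i).$$ The loss is $L_n(\theta,\mathbf q)=\frac1n\sum_{i=1}^n l_i(\theta_i,q_i)$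 with $l_i(\theta_i,q)=\mathbb E_{Y\sim N(\theta_i,\sigma_{f,i})}\big[b_i(Y-q)^++h_i(q-Y)^+\big]$. **Risk estimate.** Let $$c_i(\tau)=\sqrt{\frac{\sigma_{f,i}+\alpha_i(\tau)\sigma_{p,i}}{\sigma_{f,i}+\alpha_i(\tau)^2\sigma_{p,i}}}\;\Phi^{-1}(\tilde b_i),\qquad d_i(\tau)=-\frac{1-\alpha_i(\tau)}{\sqrt{\sigma_{f,i}+\alpha_i(\tau)^2\sigma_{p,i}}}.$$ Fix constants $\gamma_i<\frac1{\sqrt{4e}}-\sqrt{\sigma_{p,i}/\sigma_{f,i}}$ with $\inf_i\gamma_i>0$, and put $\lambda_n(i)=\gamma_i\sqrt{2\log n}$ and $K_n(i)=1+\big\lceil e^2\big(\gamma_i+\sqrt{2\sigma_{p,i}/\sigma_{f,i}}\big)^2(2\log n)\big\rceil$. With $s=\sqrt{2\sigma_{p,i}d_i(\tau)^2}$ set $$S_i(u)=G(0,\tilde b_i)+G'(0,\tilde b_i)\,u+\phi(0)\sum_{k=0}^{K_n(i)-2}\frac{(-1)^kH_k(0)}{(k+2)!}\,s^{k+2}H_{k+2}(u/s),$$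 where $s^{k}H_{k}(u/s)$ is read as its limit $u^{k}$ when $s=0$; and let $\tilde S_i(u)=\max\{-n,\min\{S_i(u),n\}\}$. For $x,z\in\mathbb R$ put $U=c_i(\tau)+d_i(\tau)(x+\sqrt{\sigma_{p,i}}\,z)$, $V=c_i(\tau)+d_i(\tau)(x-\sqrt{\sigma_{p,i}}\,z)$ and $$\hat T_i(x,z,\tau)=\begin{cases}-\tilde b_i\,U & \text{if } V<-\lambda_n(i),\\ \tilde S_i(U) & \text{if } |V|\le\lambda_n(i),\\ (1-\tilde b_i)\,U & \text{if } V>\lambda_n(i),\end{cases}\qquad \hat T_i(x,\tau)=\mathbb E_{Z\sim N(0,1)}\,\hat T_i(x,Z,\tau).$$ For $\mathbf x\in\mathbb R^n$ define $$\mathrm{ARE}_n(\tau,\mathbf x)=\frac1n\sum_{i=1}^n(b_i+h_i)\sqrt{\sigma_{f,i}+\sigma_{p,i}\alpha_i(\tau)^2}\;\hat T_i(x_i,\tau),\qquad \mathrm{ARE}^{D}_n(\eta,\tau)=\mathrm{ARE}_n\big(\tau,(X_i-\eta)_{i\le n}\big).$$ **Assumptions.** - **A1.** $0<\inf_i\tilde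 b_i\le\sup_i\tilde b_i<1$ and $\sup_i(b_i+h_i)<\infty$. - **A2.** $\limsup_{n\to\infty}\frac1n\sum_{i=1}^n|\theta_i|<\infty$. - **A3.** $\sup_i\sigma_{p,i}/\sigma_{f,i}<1/(4e)$, $\sup_i\sigma_{f,i}<\infty$ and $\inf_i\sigma_{p,i}>0$. **Theorem.** Under A1, A2 and A3, with $a_n=\log\log n$, $$\lim_{n\to\infty}\ \sup_{\tau\in[0,\infty],\ |\eta|\le a_n} a_n^4\;\mathbb E\,\Big|\mathrm{ARE}^{D}_n(\eta,\tau)-L_n\big(\theta,\hat{\mathbf q}(\eta,\tau)\big)\Big|=0 .$$ -/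

import Mathlib

open MeasureTheory ProbabilityTheory Filter Topology
open scoped ENNReal NNReal

namespace PredARE

noncomputable section

/-- Standard normal density `φ`. -/
def stdPDF (w : ℝ) : ℝ := gaussianPDFReal 0 1 w

/-- Standard normal distribution function `Φ`. -/
def stdCDF (w : ℝ) : ℝ := cdf (gaussianReal 0 1) w

/-- Standard normal quantile function `Φ⁻¹` (used on `(0,1)` only). -/
def stdQuantile (p : ℝ) : ℝ := sInf {w : ℝ | p ≤ stdCDF w}

/-- `G(w,β) = φ(w) + w Φ(w) - β w`. -/
def G (w β : ℝ) : ℝ := stdPDF w + w * stdCDF w - β * w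

/-- The critical ratio `b / (b + h)`. -/
def ratio (b h : ℝ) : ℝ := b / (b + h)

/-- The shrinkage factor `α(τ) = τ / (τ + σₚ)` for `τ ∈ [0,∞]`, with `α(∞) = 1`. -/
def shrink (σp : ℝ≥0) (τ : ℝ≥0∞) : ℝ :=
  if τ = ∞ then 1 else τ.toReal / (τ.toReal + σp)

/-- The coordinatewise predictor
`α x + (1 - α) η + √(σ_f + α σₚ) Φ⁻¹(b / (b + h))`, where `α = α(τ)`. -/
def predictor (b h : ℝ) (σp σf : ℝ≥0) (η : ℝ) (τ : ℝ≥0∞) (x : ℝ) : ℝ :=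
  shrink σp τ * x + (1 - shrink σp τ) * η
    + √(σf + shrink σp τ * σp) * stdQuantile (ratio b h)

/-- The predictive check loss `E[b (Y - q)⁺ + h (q - Y)⁺]`, `Y ∼ N(θ, σ_f)` (variance `σ_f`). -/
def coordLoss (b h : ℝ) (σf : ℝ≥0) (θ q : ℝ) : ℝ :=
  ∫ y, (b * max (y - q) 0 + h * max (q - y) 0) ∂(gaussianReal θ σf)

/-- The cumulative predictive loss `L_n(θ, q) = n⁻¹ ∑ l_i(θ_i, q_i)`; coordinates are
numbered from `0`. -/
def avgLoss (n : ℕ) (b h : ℕ → ℝ) (σf : ℕ → ℝ≥0) (θ : ℕ → ℝ) (q : Fin n → ℝ) : ℝ :=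
  (n : ℝ)⁻¹ * ∑ i : Fin n, coordLoss (b i) (h i) (σf i) (θ i) (q i)

/-- `c(τ) = √((σ_f + α σₚ) / (σ_f + α² σₚ)) Φ⁻¹(b / (b + h))`. -/
def cCoef (b h : ℝ) (σp σf : ℝ≥0) (τ : ℝ≥0∞) : ℝ :=
  √((σf + shrink σp τ * σp) / (σf + shrink σp τ ^ 2 * σp)) * stdQuantile (ratio b h)

/-- `d(τ) = -(1 - α) / √(σ_f + α² σₚ)`. -/
def dCoef (σp σf : ℝ≥0) (τ : ℝ≥0∞) : ℝ :=
  -(1 - shrink σp τ) / √(σf + shrink σp τ ^ 2 * σp)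

/-- The `k`-th probabilists' Hermite polynomial, evaluated at a real number. -/
def herm (k : ℕ) (x : ℝ) : ℝ := Polynomial.aeval x (Polynomial.hermite k)

/-- The scaled Hermite polynomial `s ^ k H_k(u / s)`, written as a polynomial in `s` and `u`
so that `s = 0` is allowed (the value is then the limit `u ^ k`). -/
def scaledHerm (k : ℕ) (s u : ℝ) : ℝ :=
  ∑ j ∈ Finset.range (k + 1), ((Polynomial.hermite k).coeff j : ℝ) * s ^ (k - j) * u ^ j

theorem scaledHerm_of_ne_zero (k : ℕ) {s : ℝ} (hs : s ≠ 0) (u : ℝ) :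
    scaledHerm k s u = s ^ k * herm k (u / s) := by
  unfold scaledHerm herm
  rw [Polynomial.aeval_eq_sum_range, Polynomial.natDegree_hermite, Finset.mul_sum]
  refine Finset.sum_congr rfl fun j hj => ?_
  have hjk : j ≤ k := Nat.lt_succ_iff.mp (Finset.mem_range.mp hj)
  have h1 : s ^ k = s ^ (k - j) * s ^ j := by rw [← pow_add, Nat.sub_add_cancel hjk]
  rw [h1, div_pow, zsmul_eq_mul]
  field_simp

theorem scaledHerm_zero (k : ℕ) (u : ℝ) : scaledHerm k 0 u = u ^ k := by
  unfold scaledHerm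
  rw [Finset.sum_eq_single k]
  · simp
  · intro j hj hne
    have : k - j ≠ 0 := by
      have := Finset.mem_range.mp hj
      omega
    simp [this]
  · simp

/-- The threshold `λ_n = γ √(2 log n)`. -/
def threshold (n : ℕ) (γ : ℝ) : ℝ := γ * √(2 * Real.log n)

/-- The truncation order `K_n = 1 + ⌈e² (γ + √(2 σₚ/σ_f))² (2 log n)⌉`. -/
def truncOrder (n : ℕ) (γ : ℝ) (σp σf : ℝ≥0) : ℕ :=
  1 + ⌈Real.exp 1 ^ 2 * (γ + √(2 * (σp / σf))) ^ 2 * (2 * Real.log n)⌉₊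

/-- The series estimate
`S(u) = G(0,β) + G'(0,β) u + φ(0) ∑_{k=0}^{K-2} (-1)^k H_k(0) / (k+2)! · s^(k+2) H_{k+2}(u/s)`. -/
def seriesEst (K : ℕ) (β s u : ℝ) : ℝ :=
  G 0 β + deriv (fun w => G w β) 0 * u
    + stdPDF 0 * ∑ k ∈ Finset.range (K - 1),
        (-1) ^ k * herm k 0 / ((k + 2).factorial : ℝ) * scaledHerm (k + 2) s u

/-- `S` truncated to the interval `[-n, n]`. -/
def truncSeriesEst (n K : ℕ) (β s u : ℝ) : ℝ :=
  max (-(n : ℝ)) (min (seriesEst K β s u) n)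

/-- The randomized coordinatewise threshold estimate. With added noise `z`,
`U(τ) = c + d (x + √σₚ z)` and `V(τ) = c + d (x - √σₚ z)`; the value of `V(τ)` decides
which estimate is applied to `U(τ)`. -/
def randThresholdEst (n : ℕ) (b h : ℝ) (σp σf : ℝ≥0) (γ : ℝ) (τ : ℝ≥0∞) (x z : ℝ) : ℝ :=
  let U := cCoef b h σp σf τ + dCoef σp σf τ * (x + √(σp : ℝ) * z)
  let V := cCoef b h σp σf τ + dCoef σp σf τ * (x - √(σp : ℝ) * z)
  if V < -threshold n γ then -ratio b h * U
  else if threshold n γ < V then (1 - ratio b h) * U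
  else truncSeriesEst n (truncOrder n γ σp σf) (ratio b h) (√(2 * σp * dCoef σp σf τ ^ 2)) U

/-- Rao-Blackwellization: the expectation over the noise `Z ∼ N(0,1)`, independent of `X`. -/
def thresholdEst (n : ℕ) (b h : ℝ) (σp σf : ℝ≥0) (γ : ℝ) (τ : ℝ≥0∞) (x : ℝ) : ℝ :=
  ∫ z, randThresholdEst n b h σp σf γ τ x z ∂(gaussianReal 0 1)

/-- The asymptotic risk estimate `ARE_n(τ, x)` for shrinkage towards the origin. -/
def are (n : ℕ) (b h : ℕ → ℝ) (σp σf : ℕ → ℝ≥0) (γ : ℕ → ℝ) (τ : ℝ≥0∞) (x : Fin n → ℝ) : ℝ :=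
  (n : ℝ)⁻¹ * ∑ i : Fin n,
    (b i + h i) * √(σf i + σp i * shrink (σp i) τ ^ 2)
      * thresholdEst n (b i) (h i) (σp i) (σf i) (γ i) τ (x i)

/-- The asymptotic risk estimate `AREᴰ_n(η, τ, x) = ARE_n(τ, x - η)`. -/
def areD (n : ℕ) (b h : ℕ → ℝ) (σp σf : ℕ → ℝ≥0) (γ : ℕ → ℝ) (η : ℝ) (τ : ℝ≥0∞)
    (x : Fin n → ℝ) : ℝ :=
  are n b h σp σf γ τ (fun i => x i - η)

/-- The law `N(θ, Σₚ)` of the past data `(X_1, …, X_n)`. -/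
def pastLaw (n : ℕ) (σp : ℕ → ℝ≥0) (θ : ℕ → ℝ) : Measure (Fin n → ℝ) :=
  Measure.pi fun i : Fin n => gaussianReal (θ i) (σp i)

/-- `a_n = log log n`. -/
def rate (n : ℕ) : ℝ := Real.log (Real.log n)

/-- Bounded weights:
`0 < inf b_i/(b_i+h_i) ≤ sup b_i/(b_i+h_i) < 1` and `sup (b_i + h_i) < ∞`. -/
def AssumptionA1 (b h : ℕ → ℝ) : Prop :=
  (∃ c > 0, ∀ i, c ≤ ratio (b i) (h i)) ∧ (∃ c < 1, ∀ i, ratio (b i) (h i) ≤ c) ∧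
    ∃ C, ∀ i, b i + h i ≤ C

/-- Bounded average magnitude: `limsup n⁻¹ ∑_{i ≤ n} |θ_i| < ∞`. -/
def AssumptionA2 (θ : ℕ → ℝ) : Prop :=
  limsup (fun n : ℕ => (∑ i ∈ Finset.range n, ‖θ i‖ₑ) / (n : ℝ≥0∞)) atTop < ∞

/-- Sufficient historical data: `sup σ_{p,i}/σ_{f,i} < 1/(4e)`, together with
`sup σ_{f,i} < ∞` and `inf σ_{p,i} > 0`. -/
def AssumptionA3 (σp σf : ℕ → ℝ≥0) : Prop :=
  (∃ c < 1 / (4 * Real.exp 1), ∀ i, (σp i : ℝ) / σf i ≤ c) ∧ (∃ C, ∀ i, σf i ≤ C) ∧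
    ∃ c > 0, ∀ i, c ≤ σp i

/-- Admissible threshold constants: `0 < γ_i < 1/√(4e) - √(σ_{p,i}/σ_{f,i})` for every `i`,
and `inf γ_i > 0`. -/
def AdmissibleThresholds (σp σf : ℕ → ℝ≥0) (γ : ℕ → ℝ) : Prop :=
  (∀ i, γ i < 1 / √(4 * Real.exp 1) - √((σp i : ℝ) / σf i)) ∧ ∃ c > 0, ∀ i, c ≤ γ i

end

end PredARE

namespace PredARE

/-! Standardizing the Gaussian variable `Y - q̂(X)` shows that the expected loss of a coordinate is
`(b+h) √(σf + α² σp) G(w, β)` with `β = b/(b+h)` and `w = c + d (θ - η)`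
(`integral_coordLoss_affine`, `predictor_standardize`). So the task is to estimate `G(w, β)` with
small bias and a variance that averaging over `n` coordinates absorbs.

The added noise splits the observation: `U` and `V` are independent, both `N(w, v)` with `v = 2 σp
d² ≤ 2 σp/σf` (`map_pair_eq`). Hence the choice made by `V` is independent of the estimate computed
from `U`, and the error splits into three products of a bias and a probability. In the tails, `G(w,
β)` differs from `-β w` by `posPart w` and from `(1-β) w` by `posPart (-w)`; each is tiny, or else
`V` is unlikely to lie on that side (`posPart_mul_tail_le`). In the middle, `√v ^ k H_k(U/√v)` has
mean `w ^ k`, so the series estimates a Taylor polynomial of `G` without bias.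

The middle estimate is controlled with a radius `R > lam`. If `|w| ≤ R`, the Taylor remainder is
small and the second moment of the series is at most `n^(3/5)` up to powers of `log n`. If `|w| >
R`, the series is used with probability at most `n^(-6/5)`, which beats its truncation at `n`.
Altogether, up to powers of `log n`, the bias is at most `exp(-lam²/8) + n^(-1/5)` and the mean
squared error at most `n^(4/5)` (`abs_integral_pairEst_sub_le`, `integral_pairEst_sub_sq_le`), with
bounds independent of `τ`, `η` and `θ`. Averaging over `Z` keeps the mean and does not increase the
mean squared error (`thresholdEst_moments`).

The loss itself is Lipschitz in the predictor, so it has bounded variance. By independence the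
variance of the average is of order `n^(-1/5)` up to logarithms; as `inf γ > 0` makes `exp(-lam²/8)`
a negative power of `n`, the factor `(log log n)^4` is harmless. -/

/-! ### Gaussian moments of scaled Hermite polynomials. -/

open Polynomial in
/-- Polynomials are integrable against Gaussian measures. -/
theorem integrable_eval_gaussianReal (w : ℝ) (v : ℝ≥0) (p : ℝ[X]) :
    Integrable (fun x => p.eval x) (gaussianReal w v) := by
  induction p using Polynomial.induction_on' with
  | add p q hp hq => exact (hp.add hq).congr (.of_forall fun x => by simp)
  | monomial n a =>
    simp only [eval_monomial]
    refine Integrable.const_mul ?_ _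
    have := (memLp_id_gaussianReal (μ := w) (v := v) n).integrable_norm_pow'
    refine (integrable_norm_iff (by fun_prop)).1 ?_
    simpa using this

open Polynomial in
theorem memLp_eval_gaussianReal (w : ℝ) (v : ℝ≥0) (p : ℝ[X]) :
    MemLp (fun x => p.eval x) 2 (gaussianReal w v) := by
  refine (memLp_two_iff_integrable_sq (by fun_prop)).2 ?_
  exact (integrable_eval_gaussianReal w v (p ^ 2)).congr (.of_forall fun x => by simp)

theorem hasDerivAt_gaussianPDFReal (w : ℝ) {v : ℝ≥0} (hv : v ≠ 0) (x : ℝ) :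
    HasDerivAt (gaussianPDFReal w v) (-((x - w) / v) * gaussianPDFReal w v x) x := by
  have hv' : (v : ℝ) ≠ 0 := by exact_mod_cast hv
  have h : HasDerivAt (fun x : ℝ => -(x - w) ^ 2 / (2 * v)) (-((x - w) / v)) x := by
    have := ((((hasDerivAt_id x).sub_const w).pow 2).neg).div_const (2 * (v : ℝ))
    refine this.congr_deriv ?_
    simp
    field_simp
  have := (h.exp).const_mul (√(2 * Real.pi * v))⁻¹
  refine (this.congr_deriv ?_)
  rw [gaussianPDFReal]
  ring

open Polynomial in
/-- Stein's identity for polynomials. -/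
theorem integral_sub_mul_eval_gaussianReal (w : ℝ) (v : ℝ≥0) (p : ℝ[X]) :
    ∫ x, (x - w) * p.eval x ∂(gaussianReal w v)
      = v * ∫ x, (derivative p).eval x ∂(gaussianReal w v) := by
  by_cases hv : v = 0
  · subst hv; simp
  have hv' : (v : ℝ) ≠ 0 := by exact_mod_cast hv
  have hint : ∀ q : ℝ[X], Integrable (fun x => q.eval x * gaussianPDFReal w v x) := by
    intro q
    have h := integrable_eval_gaussianReal w v q
    rw [gaussianReal_of_var_ne_zero _ hv, integrable_withDensity_iff_integrable_smul'
      (measurable_gaussianPDF w v) (by simp [gaussianPDF])] at h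
    refine h.congr (.of_forall fun x => ?_)
    simp [toReal_gaussianPDF, mul_comm]
  have key := integral_mul_deriv_eq_deriv_mul_of_integrable
    (u := fun x => p.eval x) (v := gaussianPDFReal w v) (u' := fun x => (derivative p).eval x)
    (v' := fun x => -((x - w) / v) * gaussianPDFReal w v x)
    (fun x _ => p.hasDerivAt x) (fun x _ => hasDerivAt_gaussianPDFReal w hv x) ?_ (hint _) (hint _)
  · rw [integral_gaussianReal_eq_integral_smul hv, integral_gaussianReal_eq_integral_smul hv]
    have e1 : ∫ x, gaussianPDFReal w v x • ((x - w) * p.eval x)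
        = -(v : ℝ) * ∫ x, p.eval x * (-((x - w) / v) * gaussianPDFReal w v x) := by
      rw [← integral_const_mul]
      congr 1 with x
      simp only [smul_eq_mul]
      field_simp
    rw [e1, key]
    simp only [smul_eq_mul, mul_comm (gaussianPDFReal w v _)]
    ring
  · refine (hint (C (-(1 / (v : ℝ))) * (X - C w) * p)).congr (.of_forall fun x => ?_)
    simp
    ring

open Polynomial in
/-- The polynomial `u ↦ s ^ k H_k(u / s)`, defined through its three-term structure. -/
noncomputable def scaledHermPoly (s : ℝ) : ℕ → ℝ[X]
  | 0 => 1
  | k + 1 => X * scaledHermPoly s k - C (s ^ 2) * derivative (scaledHermPoly s k)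

open Polynomial in
theorem derivative_scaledHermPoly (s : ℝ) (k : ℕ) :
    derivative (scaledHermPoly s (k + 1)) = (k + 1 : ℝ[X]) * scaledHermPoly s k := by
  induction k with
  | zero => simp [scaledHermPoly]
  | succ k ih =>
    rw [scaledHermPoly, derivative_sub, derivative_mul, derivative_X, ih, derivative_mul,
      derivative_C, derivative_mul]
    have : derivative ((k : ℝ[X]) + 1) = 0 := by simp
    rw [this, scaledHermPoly]
    push_cast
    ring

-- Identifies the recursive polynomial with the explicit sum in `scaledHerm`, including at `s = 0`,
-- where division by `s` is unavailable.
open Polynomial in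
theorem coeff_scaledHermPoly (s : ℝ) (k j : ℕ) :
    (scaledHermPoly s k).coeff j = ((hermite k).coeff j : ℝ) * s ^ (k - j) := by
  induction k generalizing j with
  | zero => cases j <;> simp [scaledHermPoly, coeff_one]
  | succ k ih =>
    rw [scaledHermPoly, coeff_sub, coeff_C_mul, coeff_derivative, ih]
    -- The exponents use truncated subtraction: for `k < j + 1` the Hermite coefficient vanishes,
    -- and `k = j + 1` is the boundary case.
    have e : ∀ j, (hermite k).coeff (j + 1) * s ^ (k - (j + 1)) * s ^ 2
        = (hermite k).coeff (j + 1) * s ^ (k + 1 - j) := by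
      intro j
      rcases lt_trichotomy k (j + 1) with hk | hk | hk
      · simp [coeff_hermite_of_lt hk]
      · rw [hk, Nat.sub_self, pow_zero, mul_one]
        congr 2; omega
      · rw [mul_assoc, ← pow_add]; congr 2; omega
    cases j with
    | zero =>
      rw [coeff_hermite_succ_zero, coeff_X_mul_zero]
      have := e 0
      push_cast
      simp only [zero_add, Nat.sub_zero] at *
      linear_combination -this
    | succ j =>
      rw [coeff_X_mul, ih, coeff_hermite_succ_succ]
      have := e (j + 1)
      push_cast
      rw [Nat.add_sub_add_right] at *
      linear_combination -((j : ℝ) + 1 + 1) * this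

open Polynomial in
theorem eval_scaledHermPoly (s u : ℝ) (k : ℕ) :
    (scaledHermPoly s k).eval u = scaledHerm k s u := by
  have hd : (scaledHermPoly s k).natDegree < k + 1 := by
    refine Nat.lt_succ_of_le (natDegree_le_iff_coeff_eq_zero.2 fun N hN => ?_)
    rw [coeff_scaledHermPoly, coeff_hermite_of_lt hN]; simp
  rw [eval_eq_sum_range' hd]
  simp only [coeff_scaledHermPoly]
  rfl

-- Stein's identity applied to `Q_m p`: the term `v Q_m' p` it produces cancels the one in `Q_{m+1}
-- = x Q_m - v Q_m'`, leaving the derivative on `p` only. All moments below follow by induction from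
-- this.
open Polynomial in
theorem integral_scaledHermPoly_succ_mul (w : ℝ) (v : ℝ≥0) (m : ℕ) (p : ℝ[X]) :
    ∫ x, (scaledHermPoly √v (m + 1) * p).eval x ∂(gaussianReal w v)
      = w * ∫ x, (scaledHermPoly √v m * p).eval x ∂(gaussianReal w v)
        + v * ∫ x, (scaledHermPoly √v m * derivative p).eval x ∂(gaussianReal w v) := by
  have hs := integral_sub_mul_eval_gaussianReal w v (scaledHermPoly √v m * p)
  have e : ∫ x, (scaledHermPoly √v (m + 1) * p).eval x ∂(gaussianReal w v)
      = ∫ x, ((x - w) * (scaledHermPoly √v m * p).eval x + w * (scaledHermPoly √v m * p).eval x)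
          - v * (derivative (scaledHermPoly √v m) * p).eval x ∂(gaussianReal w v) := by
    congr 1 with x
    simp [scaledHermPoly]
    ring
  have i1 : Integrable (fun x => (x - w) * (scaledHermPoly √v m * p).eval x)
      (gaussianReal w v) := by
    exact (integrable_eval_gaussianReal w v ((X - C w) * (scaledHermPoly √v m * p))).congr
      (.of_forall fun x => by simp)
  have i2 := fun q : ℝ[X] => integrable_eval_gaussianReal w v q
  have i12 : Integrable (fun x => (x - w) * (scaledHermPoly √v m * p).eval x
      + w * (scaledHermPoly √v m * p).eval x) (gaussianReal w v) := i1.add ((i2 _).const_mul _)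
  rw [e, integral_sub i12 ((i2 _).const_mul _),
    integral_add i1 ((i2 _).const_mul _), hs, integral_const_mul, integral_const_mul,
    derivative_mul]
  simp only [eval_add]
  rw [integral_add (i2 _) (i2 _)]
  ring

open Polynomial in
theorem integral_scaledHermPoly (w : ℝ) (v : ℝ≥0) (m : ℕ) :
    ∫ x, (scaledHermPoly √v m).eval x ∂(gaussianReal w v) = w ^ m := by
  induction m with
  | zero => simp [scaledHermPoly]
  | succ m ih =>
    have := integral_scaledHermPoly_succ_mul w v m 1
    simp only [mul_one, ih, derivative_one, mul_zero, eval_zero, integral_zero, add_zero] at this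
    rw [this]; ring

-- Induction on `m`: the derivative of `Q_l` is `l Q_{l-1}`, so the two terms of the recursion
-- combine through Pascal's rule.
open Polynomial in
theorem integral_scaledHermPoly_mul (w : ℝ) (v : ℝ≥0) (m l : ℕ) :
    ∫ x, (scaledHermPoly √v m * scaledHermPoly √v l).eval x ∂(gaussianReal w v)
      = ∑ j ∈ Finset.range (m + 1),
          (m.choose j : ℝ) * l.descFactorial j * (v : ℝ) ^ j * w ^ (m - j) * w ^ (l - j) := by
  induction m generalizing l with
  | zero => simpa [scaledHermPoly] using integral_scaledHermPoly w v l
  | succ m ih =>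
    rw [integral_scaledHermPoly_succ_mul, ih]
    have h2 : ∫ x, (scaledHermPoly √v m * derivative (scaledHermPoly √v l)).eval x
        ∂(gaussianReal w v) = l * ∑ j ∈ Finset.range (m + 1), (m.choose j : ℝ)
          * (l - 1).descFactorial j * (v : ℝ) ^ j * w ^ (m - j) * w ^ (l - 1 - j) := by
      cases l with
      | zero => simp [scaledHermPoly]
      | succ l =>
        simp only [Nat.add_sub_cancel]
        rw [← ih, ← integral_const_mul, derivative_scaledHermPoly]
        congr 1 with x
        simp
        ring
    rw [h2, Finset.sum_range_succ' _ (m + 1)]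
    have h3 : ∀ j ∈ Finset.range (m + 1), ((m + 1).choose (j + 1) : ℝ) * l.descFactorial (j + 1)
        * (v : ℝ) ^ (j + 1) * w ^ (m + 1 - (j + 1)) * w ^ (l - (j + 1))
        = v * (l * ((m.choose j : ℝ) * (l - 1).descFactorial j * (v : ℝ) ^ j * w ^ (m - j)
            * w ^ (l - 1 - j)))
          + w * (m.choose (j + 1) * l.descFactorial (j + 1)
            * (v : ℝ) ^ (j + 1) * w ^ (m - (j + 1)) * w ^ (l - (j + 1))) := by
      intro j hj
      have hd : (l.descFactorial (j + 1) : ℝ) = l * (l - 1).descFactorial j := by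
        cases l with
        | zero => simp
        | succ l => rw [Nat.succ_descFactorial_succ]; push_cast; simp
      have e1 : l - 1 - j = l - (j + 1) := by omega
      -- At `j = m` the truncated exponent is wrong, but the binomial coefficient is zero.
      have e2 : (m.choose (j + 1) : ℝ) * w ^ (m - j)
          = m.choose (j + 1) * (w * w ^ (m - (j + 1))) := by
        rcases Nat.lt_or_ge j m with h | h
        · rw [← pow_succ']; congr 2; omega
        · rw [Nat.choose_eq_zero_of_lt (by omega)]; simp
      rw [Nat.choose_succ_succ, Nat.add_sub_add_right, e1, hd]
      push_cast
      linear_combination (l * (l - 1).descFactorial j * (v : ℝ) ^ (j + 1) * w ^ (l - (j + 1))) * e2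
    rw [Finset.sum_congr rfl h3, Finset.sum_add_distrib, ← Finset.mul_sum, ← Finset.mul_sum,
      ← Finset.mul_sum]
    have h4 := Finset.sum_range_succ' (fun j => (m.choose j : ℝ) * l.descFactorial j * (v : ℝ) ^ j
      * w ^ (m - j) * w ^ (l - j)) (m + 1)
    rw [Finset.sum_range_succ] at h4
    simp only [Nat.choose_succ_self, Nat.cast_zero, zero_mul, add_zero] at h4
    rw [h4]
    simp
    ring

open Polynomial in
/-- Second moments of the scaled Hermite polynomials. -/
theorem integral_scaledHermPoly_sq_le (w : ℝ) {v : ℝ≥0} (hv : (v : ℝ) ≤ 1 / 5) (m : ℕ) :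
    ∫ x, (scaledHermPoly √v m).eval x ^ 2 ∂(gaussianReal w v)
      ≤ m.factorial * Real.exp (5 / 4 * w ^ 2) := by
  have h := integral_scaledHermPoly_mul w v m m
  simp only [eval_mul] at h
  simp only [sq (eval _ _)]
  rw [h]
  -- The factor `(w²)^(m-j)/(m-j)!` is at most `(4/5)^(m-j) exp(5 w²/4)`. With `v ≤ 1/5` this leaves
  -- the binomial weights of `(1/5 + 4/5)^m = 1`.
  have hterm : ∀ j ∈ Finset.range (m + 1),
      (m.choose j : ℝ) * m.descFactorial j * (v : ℝ) ^ j * w ^ (m - j) * w ^ (m - j)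
      ≤ m.factorial * Real.exp (5 / 4 * w ^ 2)
        * ((1 / 5 : ℝ) ^ j * (4 / 5 : ℝ) ^ (m - j) * m.choose j) := by
    intro j hj
    have hjm : j ≤ m := Nat.lt_succ_iff.1 (Finset.mem_range.1 hj)
    have hd : ((m - j).factorial : ℝ) * m.descFactorial j = m.factorial := by
      exact_mod_cast Nat.factorial_mul_descFactorial hjm
    have hf : (0 : ℝ) < (m - j).factorial := by positivity
    have he := Real.pow_div_factorial_le_exp (5 / 4 * w ^ 2) (by positivity) (m - j)
    have hvj : (v : ℝ) ^ j ≤ (1 / 5 : ℝ) ^ j := pow_le_pow_left₀ v.2 hv j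
    have hw : w ^ (m - j) * w ^ (m - j)
        = (5 / 4 * w ^ 2) ^ (m - j) / (m - j).factorial * (4 / 5) ^ (m - j)
          * (m - j).factorial := by
      rw [div_mul_eq_mul_div, ← mul_pow, div_mul_cancel₀ _ hf.ne', ← mul_pow]
      congr 1; ring
    calc (m.choose j : ℝ) * m.descFactorial j * (v : ℝ) ^ j * w ^ (m - j) * w ^ (m - j)
        = (m.choose j : ℝ) * m.factorial * (v : ℝ) ^ j
          * ((5 / 4 * w ^ 2) ^ (m - j) / (m - j).factorial * (4 / 5) ^ (m - j)) := by
            rw [mul_assoc _ (w ^ (m - j)), hw, ← hd]; ring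
      _ ≤ (m.choose j : ℝ) * m.factorial * (1 / 5 : ℝ) ^ j
          * (Real.exp (5 / 4 * w ^ 2) * (4 / 5) ^ (m - j)) := by gcongr
      _ = _ := by ring
  refine (Finset.sum_le_sum hterm).trans ?_
  rw [← Finset.mul_sum, ← add_pow]
  norm_num


/-! ### The standard normal law and the function `G`. -/

theorem stdPDF_eq (x : ℝ) : stdPDF x = stdPDF 0 * Real.exp (-(x ^ 2 / 2)) := by
  simp [stdPDF, gaussianPDFReal, neg_div]

theorem stdPDF_nonneg (x : ℝ) : 0 ≤ stdPDF x := gaussianPDFReal_nonneg 0 1 x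

theorem stdPDF_zero_le : stdPDF 0 ≤ 1 / 2 := by
  have h : (2 : ℝ) ≤ √(2 * Real.pi) := by
    refine Real.le_sqrt_of_sq_le ?_
    linarith [Real.pi_gt_three]
  simp only [stdPDF, gaussianPDFReal, NNReal.coe_one, mul_one, sub_self]
  norm_num only [Real.exp_zero]
  simp only [mul_one]
  rw [one_div]
  exact inv_anti₀ (by norm_num) h

theorem stdPDF_le_exp (x : ℝ) : stdPDF x ≤ Real.exp (-(x ^ 2 / 2)) := by
  rw [stdPDF_eq]
  have := stdPDF_zero_le
  have h := Real.exp_pos (-(x ^ 2 / 2))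
  nlinarith

theorem stdPDF_le_half (x : ℝ) : stdPDF x ≤ 1 / 2 := by
  rw [stdPDF_eq]
  have := stdPDF_zero_le
  have h0 := stdPDF_nonneg 0
  have h : Real.exp (-(x ^ 2 / 2)) ≤ 1 := Real.exp_le_one_iff.2 (by nlinarith [sq_nonneg x])
  nlinarith

theorem stdPDF_neg (x : ℝ) : stdPDF (-x) = stdPDF x := by
  rw [stdPDF_eq, stdPDF_eq x, neg_sq]

theorem hasDerivAt_stdPDF (x : ℝ) : HasDerivAt stdPDF (-x * stdPDF x) x := by
  simpa [stdPDF] using! hasDerivAt_gaussianPDFReal 0 one_ne_zero x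

theorem stdCDF_eq_integral (x : ℝ) : stdCDF x = ∫ t in Set.Iic x, stdPDF t := by
  rw [stdCDF, cdf_eq_real, Measure.real, gaussianReal_apply_eq_integral _ one_ne_zero,
    ENNReal.toReal_ofReal (integral_nonneg fun t => gaussianPDFReal_nonneg _ _ _)]
  rfl

theorem stdCDF_nonneg (x : ℝ) : 0 ≤ stdCDF x := cdf_nonneg _ _

theorem stdCDF_le_one (x : ℝ) : stdCDF x ≤ 1 := cdf_le_one _ _

theorem hasDerivAt_stdCDF (x : ℝ) : HasDerivAt stdCDF (stdPDF x) x := by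
  have hint : Integrable stdPDF := integrable_gaussianPDFReal 0 1
  have hcont : Continuous stdPDF :=
    continuous_iff_continuousAt.2 fun y => (hasDerivAt_stdPDF y).continuousAt
  have h : ∀ y, stdCDF y = stdCDF 0 + ∫ t in (0 : ℝ)..y, stdPDF t := by
    intro y
    rw [stdCDF_eq_integral, stdCDF_eq_integral,
      ← intervalIntegral.integral_Iic_sub_Iic hint.integrableOn hint.integrableOn]
    ring
  have := (intervalIntegral.integral_hasDerivAt_right (hcont.intervalIntegrable 0 x)
    hcont.stronglyMeasurable.stronglyMeasurableAtFilter hcont.continuousAt).const_add (stdCDF 0)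
  exact this.congr_of_eventuallyEq (.of_forall h)

/-- The sum `Φ(-y) + Φ(y)` has zero derivative and tends to `1`. -/
theorem stdCDF_neg (x : ℝ) : stdCDF (-x) = 1 - stdCDF x := by
  have h : ∀ y, HasDerivAt (fun y => stdCDF (-y) + stdCDF y) 0 y := by
    intro y
    have h1 := (hasDerivAt_stdCDF (-y)).comp y (hasDerivAt_neg y)
    refine (h1.add (hasDerivAt_stdCDF y)).congr_deriv ?_
    rw [stdPDF_neg]; ring
  have hc := is_const_of_deriv_eq_zero (fun y => (h y).differentiableAt) (fun y => (h y).deriv)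
  have ht : Tendsto (fun y => stdCDF (-y) + stdCDF y) atTop (𝓝 (0 + 1)) :=
    ((tendsto_cdf_atBot (gaussianReal 0 1)).comp tendsto_neg_atTop_atBot).add
      (tendsto_cdf_atTop (gaussianReal 0 1))
  have := tendsto_nhds_unique ht
    (tendsto_const_nhds.congr fun y => (hc y x).symm)
  linarith

theorem hasDerivAt_G (β x : ℝ) : HasDerivAt (fun w => G w β) (stdCDF x - β) x := by
  have := ((hasDerivAt_stdPDF x).add ((hasDerivAt_id x).mul (hasDerivAt_stdCDF x))).sub
    ((hasDerivAt_id x).const_mul β)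
  refine this.congr_deriv ?_
  simp

theorem deriv_G (β x : ℝ) : deriv (fun w => G w β) x = stdCDF x - β := (hasDerivAt_G β x).deriv

theorem abs_stdCDF_sub_le {β : ℝ} (h0 : 0 ≤ β) (h1 : β ≤ 1) (x : ℝ) : |stdCDF x - β| ≤ 1 := by
  have := stdCDF_nonneg x
  have := stdCDF_le_one x
  rw [abs_le]; constructor <;> linarith

theorem abs_G_le {β : ℝ} (h0 : 0 ≤ β) (h1 : β ≤ 1) (w : ℝ) : |G w β| ≤ 1 + |w| := by
  have e : G w β = stdPDF w + w * (stdCDF w - β) := by rw [G]; ring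
  have h2 : |w * (stdCDF w - β)| ≤ |w| * 1 := by
    rw [abs_mul]; gcongr; exact abs_stdCDF_sub_le h0 h1 w
  have h3 := stdPDF_le_half w
  have h4 := stdPDF_nonneg w
  calc |G w β| ≤ |stdPDF w| + |w * (stdCDF w - β)| := e ▸ abs_add_le _ _
    _ ≤ 1 + |w| := by rw [abs_of_nonneg h4]; linarith

/-- The function `-z φ(z)` is the derivative of `φ`, so its integral up to `a` is `φ(a)`. The
identity also makes `posPart` visibly nonnegative. -/
theorem integral_max_sub_std (a : ℝ) :
    ∫ z, max (a - z) 0 ∂(gaussianReal 0 1) = stdPDF a + a * stdCDF a := by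
  have hint : Integrable stdPDF := integrable_gaussianPDFReal 0 1
  have hid : Integrable (fun z => z * stdPDF z) := by
    have h : Integrable (fun z : ℝ => z) (gaussianReal 0 1) := by
      simpa using integrable_eval_gaussianReal 0 1 Polynomial.X
    rw [gaussianReal_of_var_ne_zero _ one_ne_zero, integrable_withDensity_iff_integrable_smul'
      (measurable_gaussianPDF 0 1) (by simp [gaussianPDF])] at h
    refine h.congr (.of_forall fun x => ?_)
    simp [toReal_gaussianPDF, mul_comm, stdPDF]
  have hbot : Tendsto stdPDF atBot (𝓝 0) :=
    tendsto_zero_of_hasDerivAt_of_integrableOn_Iic (a := 0)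
      (fun x _ => hasDerivAt_stdPDF x)
      (by simpa [neg_mul] using! hid.neg.integrableOn) hint.integrableOn
  have h1 : ∫ z in Set.Iic a, -z * stdPDF z = stdPDF a - 0 :=
    integral_Iic_of_hasDerivAt_of_tendsto' (fun x _ => hasDerivAt_stdPDF x)
      (by simpa [neg_mul] using! hid.neg.integrableOn) hbot
  rw [integral_gaussianReal_eq_integral_smul one_ne_zero, stdCDF_eq_integral]
  have h2 : ∫ z, gaussianPDFReal 0 1 z • max (a - z) 0
      = ∫ z in Set.Iic a, (a * stdPDF z + -z * stdPDF z) := by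
    rw [← integral_indicator measurableSet_Iic]
    congr 1 with z
    by_cases hz : z ≤ a
    · rw [Set.indicator_of_mem (by exact hz), max_eq_left (by linarith)]
      simp [stdPDF]; ring
    · rw [Set.indicator_of_notMem (by exact hz), max_eq_right (by linarith)]
      simp
  rw [h2, integral_add (hint.const_mul a).integrableOn
    (by simpa [neg_mul] using! hid.neg.integrableOn), h1, integral_const_mul]
  ring

/-- The function `φ(w) + w Φ(w)`. -/
noncomputable def posPart (w : ℝ) : ℝ := stdPDF w + w * stdCDF w

theorem posPart_nonneg (w : ℝ) : 0 ≤ posPart w := by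
  rw [posPart, ← integral_max_sub_std]
  exact integral_nonneg fun z => le_max_right _ _

/-- This and the next identity exhibit `posPart (±w)` as the error of the two linear approximations
used beyond the threshold. -/
theorem G_eq_posPart (w β : ℝ) : G w β = posPart w - β * w := rfl

theorem G_eq_posPart_neg (w β : ℝ) : G w β = posPart (-w) + (1 - β) * w := by
  rw [G, posPart, stdPDF_neg, stdCDF_neg]; ring

theorem posPart_le (w : ℝ) : posPart w ≤ 1 + |w| := by
  have h := (le_abs_self _).trans (abs_G_le le_rfl zero_le_one w)
  rwa [G_eq_posPart, zero_mul, sub_zero] at h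

theorem posPart_le_exp {w : ℝ} (hw : w ≤ 0) : posPart w ≤ Real.exp (-(w ^ 2 / 2)) := by
  have := stdPDF_le_exp w
  have := mul_nonpos_of_nonpos_of_nonneg hw (stdCDF_nonneg w)
  rw [posPart]; linarith

/-! ### Taylor expansion of `G` at the origin. -/

/-- Integrating a power bound on a derivative, on the half line. -/
theorem abs_le_of_abs_deriv_le_pow_of_nonneg {f f' : ℝ → ℝ} {C : ℝ} {m : ℕ} (h0 : f 0 = 0)
    (hf : ∀ x, HasDerivAt f (f' x) x) (hb : ∀ x, 0 ≤ x → |f' x| ≤ C * x ^ m) {x : ℝ}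
    (hx : 0 ≤ x) : |f x| ≤ C * x ^ (m + 1) / (m + 1) := by
  have hm : (m : ℝ) + 1 ≠ 0 := by positivity
  refine image_norm_le_of_norm_deriv_right_le_deriv_boundary (a := 0) (b := x)
    (B := fun x => C * x ^ (m + 1) / (m + 1)) (B' := fun x => C * x ^ m)
    (fun y _ => (hf y).continuousAt.continuousWithinAt)
    (fun y _ => (hf y).hasDerivWithinAt) (by simp [h0]) (fun y => ?_)
    (fun y hy => hb y hy.1) ⟨hx, le_rfl⟩
  have := ((hasDerivAt_pow (m + 1) y).const_mul C).div_const ((m : ℝ) + 1)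
  refine this.congr_deriv ?_
  push_cast
  field_simp

/-- Integrating a power bound on a derivative. -/
theorem abs_le_of_abs_deriv_le_pow {f f' : ℝ → ℝ} {C : ℝ} {m : ℕ} (hC : 0 ≤ C) (h0 : f 0 = 0)
    (hf : ∀ x, HasDerivAt f (f' x) x) (hb : ∀ x, |f' x| ≤ C * |x| ^ m) (x : ℝ) :
    |f x| ≤ C * |x| ^ (m + 1) := by
  have key : ∀ {g g' : ℝ → ℝ}, g 0 = 0 → (∀ x, HasDerivAt g (g' x) x) →
      (∀ x, |g' x| ≤ C * |x| ^ m) → ∀ y, 0 ≤ y → |g y| ≤ C * y ^ (m + 1) := by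
    intro g g' hg0 hg hgb y hy
    refine (abs_le_of_abs_deriv_le_pow_of_nonneg hg0 hg
      (fun z hz => by simpa [abs_of_nonneg hz] using hgb z) hy).trans ?_
    refine div_le_self (by positivity) ?_
    have : (0 : ℝ) ≤ m := by positivity
    linarith
  rcases le_total 0 x with hx | hx
  · rw [abs_of_nonneg hx]; exact key h0 hf hb x hx
  · have := key (g := fun y => f (-y)) (g' := fun y => -f' (-y)) (by simpa using h0)
      (fun y => by simpa using! (hf (-y)).comp y (hasDerivAt_neg y))
      (fun y => by simpa using hb (-y)) (-x) (by linarith)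
    simpa [abs_of_nonpos hx] using this

/-- The derivative of the remainder of order `M + 1` is minus the remainder of order `M`, so the
bound is integrated once per induction step. -/
theorem abs_exp_neg_sub_sum_le (M : ℕ) {y : ℝ} (hy : 0 ≤ y) :
    |Real.exp (-y) - ∑ m ∈ Finset.range M, (-y) ^ m / m.factorial| ≤ y ^ M / M.factorial := by
  induction M generalizing y with
  | zero => simpa [abs_of_pos (Real.exp_pos _)] using hy
  | succ M ih =>
    have h := abs_le_of_abs_deriv_le_pow_of_nonneg
      (f := fun y => Real.exp (-y) - ∑ m ∈ Finset.range (M + 1), (-y) ^ m / m.factorial)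
      (f' := fun y => -(Real.exp (-y) - ∑ m ∈ Finset.range M, (-y) ^ m / m.factorial))
      (C := 1 / M.factorial) (m := M) ?_ ?_ ?_ hy
    · refine h.trans (le_of_eq ?_)
      rw [Nat.factorial_succ]; push_cast
      have : (M.factorial : ℝ) ≠ 0 := by positivity
      field_simp
    · simp [Finset.sum_range_succ']
    · intro x
      have h1 := (Real.hasDerivAt_exp (-x)).comp x (hasDerivAt_neg x)
      have h2 : HasDerivAt (fun y : ℝ => ∑ m ∈ Finset.range (M + 1), (-y) ^ m / m.factorial)
          (∑ m ∈ Finset.range (M + 1), (m : ℝ) * (-x) ^ (m - 1) * -1 / m.factorial) x := by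
        refine HasDerivAt.fun_sum fun m _ => ?_
        exact ((hasDerivAt_pow m (-x)).comp x (hasDerivAt_neg x)).div_const _
      refine (h1.sub h2).congr_deriv ?_
      rw [Finset.sum_range_succ']
      have : ∀ m ∈ Finset.range M, ((m + 1 : ℕ) : ℝ) * (-x) ^ (m + 1 - 1) * -1
          / (m + 1).factorial = -((-x) ^ m / m.factorial) := by
        intro m _
        have : (m.factorial : ℝ) ≠ 0 := by positivity
        rw [Nat.factorial_succ]; push_cast
        field_simp
      rw [Finset.sum_congr rfl this, Finset.sum_neg_distrib]
      simp
      ring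
    · intro x hx
      rw [abs_neg]
      exact (ih hx).trans (le_of_eq (by ring))

open Polynomial in
theorem herm_eq_eval (k : ℕ) (x : ℝ) : herm k x = (scaledHermPoly 1 k).eval x := by
  rw [eval_scaledHermPoly, scaledHerm_of_ne_zero _ one_ne_zero]; simp

open Polynomial in
theorem herm_zero_add_two (k : ℕ) : herm (k + 2) 0 = -(k + 1) * herm k 0 := by
  rw [herm_eq_eval, herm_eq_eval, scaledHermPoly, derivative_scaledHermPoly]
  simp
  ring

theorem herm_zero_zero : herm 0 0 = 1 := by simp [herm_eq_eval, scaledHermPoly]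

theorem herm_one_zero : herm 1 0 = 0 := by simp [herm_eq_eval, scaledHermPoly]

theorem herm_zero_sq_le (k : ℕ) : herm k 0 ^ 2 ≤ k.factorial := by
  induction k using Nat.twoStepInduction with
  | zero => simp [herm_zero_zero]
  | one => simp [herm_one_zero]
  | more k ih _ =>
    rw [herm_zero_add_two, Nat.factorial_succ, Nat.factorial_succ]
    push_cast
    have : (0 : ℝ) ≤ k := by positivity
    calc (-((k : ℝ) + 1) * herm k 0) ^ 2 = ((k : ℝ) + 1) * ((k + 1) * herm k 0 ^ 2) := by ring
      _ ≤ ((k : ℝ) + 1 + 1) * ((k + 1) * k.factorial) := by gcongr; linarith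

/-- Together with the vanishing odd values, this turns the Hermite series of `φ/φ(0)` at `0` into
the exponential series in `-x²/2`. -/
theorem herm_zero_even (m : ℕ) (x : ℝ) :
    herm (2 * m) 0 / ((2 * m).factorial : ℝ) * x ^ (2 * m)
      = (-(x ^ 2 / 2)) ^ m / m.factorial := by
  induction m with
  | zero => simp [herm_zero_zero]
  | succ m ih =>
    have h1 : ((2 * m).factorial : ℝ) ≠ 0 := by positivity
    have h2 : (m.factorial : ℝ) ≠ 0 := by positivity
    have hp : x ^ (2 * m + 2) = x ^ (2 * m) * x * x := by ring
    rw [mul_add, mul_one, hp, herm_zero_add_two, Nat.factorial_succ (2 * m + 1),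
      Nat.factorial_succ (2 * m), Nat.factorial_succ m]
    push_cast
    have e : (-(2 * (m : ℝ) + 1) * herm (2 * m) 0)
        / ((2 * m + 1 + 1) * ((2 * m + 1) * (2 * m).factorial)) * (x ^ (2 * m) * x * x)
        = (herm (2 * m) 0 / ((2 * m).factorial : ℝ) * x ^ (2 * m)) * (-(x ^ 2 / 2)) / (m + 1) := by
      field_simp
      ring
    rw [e, ih]
    generalize -(x ^ 2 / 2) = A
    field_simp
    ring

theorem herm_zero_odd (m : ℕ) : herm (2 * m + 1) 0 = 0 := by
  induction m with
  | zero => exact herm_one_zero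
  | succ m ih =>
    rw [show 2 * (m + 1) + 1 = 2 * m + 1 + 2 by ring, herm_zero_add_two, ih, mul_zero]

theorem sum_herm_zero_eq (N : ℕ) (x : ℝ) :
    ∑ k ∈ Finset.range N, (-1) ^ k * herm k 0 / (k.factorial : ℝ) * x ^ k
      = ∑ m ∈ Finset.range ((N + 1) / 2), (-(x ^ 2 / 2)) ^ m / m.factorial := by
  induction N with
  | zero => simp
  | succ N ih =>
    rw [Finset.sum_range_succ, ih]
    rcases Nat.even_or_odd' N with ⟨m, rfl | rfl⟩
    · rw [show (2 * m + 1 + 1) / 2 = (2 * m + 1) / 2 + 1 by omega, Finset.sum_range_succ,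
        show (2 * m + 1) / 2 = m by omega, ← herm_zero_even m x]
      simp
    · rw [herm_zero_odd, show (2 * m + 1 + 1 + 1) / 2 = (2 * m + 1 + 1) / 2 by omega]
      simp

/-- The Taylor polynomial of `G(·, β)` at the origin. -/
noncomputable def taylorG (K : ℕ) (β w : ℝ) : ℝ :=
  G 0 β + deriv (fun w => G w β) 0 * w
    + stdPDF 0 * ∑ k ∈ Finset.range (K - 1),
        (-1) ^ k * herm k 0 / ((k + 2).factorial : ℝ) * w ^ (k + 2)

/-- The shift `r` lets one statement serve both integrations that lead from `G'' = φ` back to `G`.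
-/
theorem hasDerivAt_sum_mul_pow (N r : ℕ) (a : ℕ → ℝ) (x : ℝ) :
    HasDerivAt (fun w : ℝ => ∑ k ∈ Finset.range N, a k / ((k + r + 1).factorial : ℝ)
        * w ^ (k + r + 1))
      (∑ k ∈ Finset.range N, a k / ((k + r).factorial : ℝ) * x ^ (k + r)) x := by
  refine HasDerivAt.fun_sum fun k _ => ?_
  refine ((hasDerivAt_pow (k + r + 1) x).const_mul _).congr_deriv ?_
  rw [Nat.factorial_succ]
  push_cast
  have : ((k + r).factorial : ℝ) ≠ 0 := by positivity
  have : (k : ℝ) + r + 1 ≠ 0 := by positivity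
  field_simp

/-- The second derivative of the remainder is `φ(0)` times an exponential remainder in `w²/2`;
integrating twice from `0` costs a factor `w²`. Only even indices below `K - 1` contribute, which
gives `K / 2` exponential terms. -/
theorem abs_G_sub_taylorG_le {K : ℕ} (hK : 1 ≤ K) (β w : ℝ) :
    |G w β - taylorG K β w| ≤ w ^ 2 * ((w ^ 2 / 2) ^ (K / 2) / (K / 2).factorial) := by
  set M := K / 2
  set a : ℕ → ℝ := fun k => (-1) ^ k * herm k 0
  set C : ℝ := (1 / 2) ^ M / M.factorial
  have hC : 0 ≤ C := by positivity
  have h0 := stdPDF_nonneg 0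
  have h0' := stdPDF_zero_le
  have b2 : ∀ x, |stdPDF x - stdPDF 0 * ∑ k ∈ Finset.range (K - 1), a k / ((k + 0).factorial : ℝ)
      * x ^ (k + 0)| ≤ C * |x| ^ (2 * M) := by
    intro x
    have hM : (K - 1 + 1) / 2 = M := by rw [Nat.sub_add_cancel hK]
    have hs := sum_herm_zero_eq (K - 1) x
    simp only [add_zero, a]
    rw [hs, hM, stdPDF_eq, ← mul_sub, abs_mul, abs_of_nonneg h0]
    have := abs_exp_neg_sub_sum_le M (y := x ^ 2 / 2) (by positivity)
    calc stdPDF 0 * |Real.exp (-(x ^ 2 / 2))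
          - ∑ m ∈ Finset.range M, (-(x ^ 2 / 2)) ^ m / m.factorial|
        ≤ 1 * ((x ^ 2 / 2) ^ M / M.factorial) := by gcongr; linarith
      _ = C * |x| ^ (2 * M) := by
        rw [pow_mul, sq_abs, div_pow, one_mul]
        simp only [C, div_pow, one_pow]
        ring
  have b1 := abs_le_of_abs_deriv_le_pow hC
    (f := fun x => stdCDF x - β - (stdCDF 0 - β)
      - stdPDF 0 * ∑ k ∈ Finset.range (K - 1), a k / ((k + 0 + 1).factorial : ℝ)
        * x ^ (k + 0 + 1)) (by simp)
    (fun x => (((hasDerivAt_stdCDF x).sub_const _).sub_const _).sub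
      ((hasDerivAt_sum_mul_pow (K - 1) 0 a x).const_mul _)) b2
  have hd : ∀ x, HasDerivAt (fun x => G x β - taylorG K β x)
      (stdCDF x - β - (stdCDF 0 - β)
      - stdPDF 0 * ∑ k ∈ Finset.range (K - 1), a k / ((k + 0 + 1).factorial : ℝ)
        * x ^ (k + 0 + 1)) x := by
    intro x
    have h1 := ((hasDerivAt_id x).const_mul (stdCDF 0 - β)).const_add (G 0 β)
    have h2 := (hasDerivAt_sum_mul_pow (K - 1) 1 a x).const_mul (stdPDF 0)
    have h3 := (hasDerivAt_G β x).sub (h1.add h2)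
    simp only [taylorG, deriv_G]
    refine h3.congr_deriv ?_
    simp
    ring
  have b0 := abs_le_of_abs_deriv_le_pow hC (by simp [taylorG]) hd b1 w
  refine b0.trans (le_of_eq ?_)
  rw [show 2 * M + 1 + 1 = 2 * (M + 1) by ring, pow_mul, sq_abs, div_pow]
  simp only [C, div_pow, one_pow]
  ring


/-! ### Gaussian tails and selection by an independent variable. -/

/-- Chernoff's bound at `t = y/r`. Using an upper bound `r` for the variance keeps the case `v = 0`,
which occurs at `τ = ∞`. -/
theorem gaussianReal_real_ge_le (w : ℝ) {v : ℝ≥0} {r y : ℝ} (hr : 0 < r) (hv : (v : ℝ) ≤ r)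
    (hy : 0 ≤ y) : (gaussianReal w v).real {x | w + y ≤ x} ≤ Real.exp (-(y ^ 2 / (2 * r))) := by
  have h := measure_ge_le_exp_mul_mgf (μ := gaussianReal w v) (X := id) (w + y) (t := y / r)
    (by positivity) (integrable_exp_mul_gaussianReal _)
  rw [mgf_id_gaussianReal, ← Real.exp_add] at h
  refine h.trans (Real.exp_le_exp.2 ?_)
  have e : (v : ℝ) * (y / r) ^ 2 ≤ r * (y / r) ^ 2 := by gcongr
  have e2 : r * (y / r) ^ 2 = y ^ 2 / r := by field_simp
  have e3 : y ^ 2 / (2 * r) = y ^ 2 / r / 2 := by field_simp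
  have e4 : -(y / r) * (w + y) = -(w * (y / r)) - y ^ 2 / r := by field_simp; ring
  rw [e4, e3]; linarith

theorem gaussianReal_real_le_le (w : ℝ) {v : ℝ≥0} {r y : ℝ} (hr : 0 < r) (hv : (v : ℝ) ≤ r)
    (hy : 0 ≤ y) : (gaussianReal w v).real {x | x ≤ w - y} ≤ Real.exp (-(y ^ 2 / (2 * r))) := by
  have h := gaussianReal_real_ge_le (-w) hr hv hy
  rw [← gaussianReal_map_neg, show {x | -w + y ≤ x} = Set.Ici (-w + y) from rfl,
    map_measureReal_apply (by fun_prop) measurableSet_Ici] at h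
  convert h using 3
  ext x
  change x ≤ w - y ↔ -w + y ≤ -x
  constructor <;> intro <;> linarith

/-- Selection among three functions of `u` according to the position of `t` relative to
`[-lam, lam]`. -/
noncomputable def select (lam : ℝ) (f₁ f₂ f₃ : ℝ → ℝ) (p : ℝ × ℝ) : ℝ :=
  if p.2 < -lam then f₁ p.1 else if lam < p.2 then f₂ p.1 else f₃ p.1

theorem select_eq_sum {lam : ℝ} (hlam : 0 ≤ lam) (f₁ f₂ f₃ : ℝ → ℝ) (p : ℝ × ℝ) :
    select lam f₁ f₂ f₃ p = f₁ p.1 * (Set.Iio (-lam)).indicator 1 p.2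
      + f₂ p.1 * (Set.Ioi lam).indicator 1 p.2 + f₃ p.1 * (Set.Icc (-lam) lam).indicator 1 p.2 := by
  unfold select
  by_cases h1 : p.2 < -lam
  · simp [Set.indicator, h1, not_le.2 h1, show ¬ lam < p.2 by linarith]
  · by_cases h2 : lam < p.2
    · simp [Set.indicator, h1, h2, not_le.2 h2]
    · simp [Set.indicator, h1, h2, not_lt.1 h1, not_lt.1 h2]

theorem integrable_mul_indicator_prod {μ ν : Measure ℝ} [IsFiniteMeasure ν]
    {f : ℝ → ℝ} (hf : Integrable f μ) {s : Set ℝ}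
    (hs : MeasurableSet s) :
    Integrable (fun p : ℝ × ℝ => f p.1 * s.indicator 1 p.2) (μ.prod ν) :=
  hf.mul_prod ((integrable_const 1).indicator hs)

section select

variable {μ ν : Measure ℝ} [IsProbabilityMeasure ν] {lam : ℝ} {f₁ f₂ f₃ : ℝ → ℝ}

theorem integrable_select (hlam : 0 ≤ lam) (h₁ : Integrable f₁ μ) (h₂ : Integrable f₂ μ)
    (h₃ : Integrable f₃ μ) : Integrable (select lam f₁ f₂ f₃) (μ.prod ν) := by
  have := ((integrable_mul_indicator_prod (ν := ν) h₁ (measurableSet_Iio (a := -lam))).add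
    (integrable_mul_indicator_prod (ν := ν) h₂ (measurableSet_Ioi (a := lam)))).add
    (integrable_mul_indicator_prod (ν := ν) h₃ (measurableSet_Icc (a := -lam) (b := lam)))
  exact this.congr (.of_forall fun p => (select_eq_sum hlam f₁ f₂ f₃ p).symm)

/-- The choice depends on the second coordinate and the value on the first, so under a product
measure each integral factors. -/
theorem integral_select [SFinite μ] (hlam : 0 ≤ lam) (h₁ : Integrable f₁ μ) (h₂ : Integrable f₂ μ)
    (h₃ : Integrable f₃ μ) :
    ∫ p, select lam f₁ f₂ f₃ p ∂(μ.prod ν) = (∫ u, f₁ u ∂μ) * ν.real (Set.Iio (-lam))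
      + (∫ u, f₂ u ∂μ) * ν.real (Set.Ioi lam) + (∫ u, f₃ u ∂μ) * ν.real (Set.Icc (-lam) lam) := by
  have i1 := integrable_mul_indicator_prod (ν := ν) h₁ (measurableSet_Iio (a := -lam))
  have i2 := integrable_mul_indicator_prod (ν := ν) h₂ (measurableSet_Ioi (a := lam))
  have i3 := integrable_mul_indicator_prod (ν := ν) h₃ (measurableSet_Icc (a := -lam) (b := lam))
  simp only [select_eq_sum hlam]
  have i12 : Integrable (fun p : ℝ × ℝ => f₁ p.1 * (Set.Iio (-lam)).indicator 1 p.2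
      + f₂ p.1 * (Set.Ioi lam).indicator 1 p.2) (μ.prod ν) := i1.add i2
  rw [integral_add i12 i3, integral_add i1 i2, integral_prod_mul f₁, integral_prod_mul f₂,
    integral_prod_mul f₃, integral_indicator_one measurableSet_Iio,
    integral_indicator_one measurableSet_Ioi, integral_indicator_one measurableSet_Icc]

theorem measureReal_add_add_eq_one (hlam : 0 ≤ lam) :
    ν.real (Set.Iio (-lam)) + ν.real (Set.Ioi lam) + ν.real (Set.Icc (-lam) lam) = 1 := by
  have := integral_select (μ := ν) (ν := ν) hlam (integrable_const (1 : ℝ))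
    (integrable_const (1 : ℝ)) (integrable_const (1 : ℝ))
  simpa [select] using this.symm

end select

/-! ### The series estimate: mean, second moment and truncation. -/

open Polynomial in
/-- The series estimate as a polynomial in the observation. -/
noncomputable def seriesEstPoly (K : ℕ) (β s : ℝ) : ℝ[X] :=
  C (G 0 β) + C (deriv (fun w => G w β) 0) * scaledHermPoly s 1
    + C (stdPDF 0) * ∑ k ∈ Finset.range (K - 1),
        C ((-1) ^ k * herm k 0 / ((k + 2).factorial : ℝ)) * scaledHermPoly s (k + 2)

theorem eval_seriesEstPoly (K : ℕ) (β s u : ℝ) :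
    (seriesEstPoly K β s).eval u = seriesEst K β s u := by
  simp [seriesEstPoly, seriesEst, Polynomial.eval_finsetSum, eval_scaledHermPoly,
    show scaledHerm 1 s u = u by simp [scaledHerm, Finset.sum_range_succ]]

theorem integral_seriesEst (K : ℕ) (β w : ℝ) (v : ℝ≥0) :
    ∫ u, seriesEst K β √v u ∂(gaussianReal w v) = taylorG K β w := by
  have hi := integrable_eval_gaussianReal w v
  have hQ : ∀ k, Integrable (fun u => scaledHerm k √v u) (gaussianReal w v) := fun k => by
    simpa only [eval_scaledHermPoly] using hi (scaledHermPoly √v k)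
  have hE : ∀ k, ∫ u, scaledHerm k √v u ∂(gaussianReal w v) = w ^ k := fun k => by
    simpa only [eval_scaledHermPoly] using integral_scaledHermPoly w v k
  have h1 : Integrable (fun u : ℝ => u) (gaussianReal w v) := by
    simpa using hi Polynomial.X
  have h2 : Integrable (fun u => G 0 β + deriv (fun w => G w β) 0 * u) (gaussianReal w v) :=
    (integrable_const _).add (h1.const_mul _)
  unfold seriesEst taylorG
  rw [integral_add h2 ((integrable_finsetSum _ fun k _ => (hQ _).const_mul _).const_mul _),
    integral_add (integrable_const _) (h1.const_mul _), integral_const_mul, integral_const_mul,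
    integral_finsetSum _ fun k _ => (hQ _).const_mul _]
  simp [integral_const_mul, hE]

/-- As `H_k(0)² ≤ k!`, the factorials in the coefficients offset the growth of the Hermite second
moments, and every term of the sum has second moment at most `exp(5 w²/4)`. Cauchy–Schwarz over at
most `K` terms gives the factor `K²`. -/
theorem integral_seriesEst_sq_le (K : ℕ) {β : ℝ} (hβ0 : 0 ≤ β) (hβ1 : β ≤ 1) (w : ℝ) {v : ℝ≥0}
    (hv : (v : ℝ) ≤ 1 / 5) :
    ∫ u, seriesEst K β √v u ^ 2 ∂(gaussianReal w v)
      ≤ 6 * (1 + (K : ℝ) ^ 2) * Real.exp (5 / 4 * w ^ 2) := by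
  set N := K - 1
  have hN : (N : ℝ) ≤ K := by exact_mod_cast Nat.sub_le K 1
  set E := Real.exp (5 / 4 * w ^ 2)
  have hE : 1 ≤ E := Real.one_le_exp (by positivity)
  set a : ℕ → ℝ := fun k => (-1) ^ k * herm k 0 / ((k + 2).factorial : ℝ)
  have hQi : ∀ k, Integrable (fun u => (scaledHermPoly √v k).eval u ^ 2) (gaussianReal w v) :=
    fun k => (memLp_eval_gaussianReal w v _).integrable_sq
  have ha : ∀ k, a k ^ 2 * ∫ u, (scaledHermPoly √v (k + 2)).eval u ^ 2 ∂(gaussianReal w v)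
      ≤ E := by
    intro k
    have h1 := integral_scaledHermPoly_sq_le w hv (k + 2)
    have h2 := herm_zero_sq_le k
    have h3 : (0 : ℝ) < (k + 2).factorial := by positivity
    have h4 : (k.factorial : ℝ) ≤ (k + 2).factorial := by
      exact_mod_cast Nat.factorial_le (by omega)
    have h5 : a k ^ 2 = herm k 0 ^ 2 / ((k + 2).factorial : ℝ) ^ 2 := by
      simp [a, div_pow, mul_pow, ← pow_mul, mul_comm k 2]
    calc _ ≤ ((k + 2).factorial : ℝ) / ((k + 2).factorial : ℝ) ^ 2
          * ((k + 2).factorial * E) := by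
            rw [h5]
            refine mul_le_mul ?_ h1 (integral_nonneg fun _ => sq_nonneg _) (by positivity)
            gcongr
            exact h2.trans h4
      _ = E := by field_simp
  have h0 : G 0 β ^ 2 ≤ 1 := by
    have := abs_G_le hβ0 hβ1 0
    rw [abs_zero, add_zero] at this
    exact (sq_le_one_iff_abs_le_one _).2 this
  have h0' : deriv (fun w => G w β) 0 ^ 2 ≤ 1 := by
    rw [deriv_G]
    exact (sq_le_one_iff_abs_le_one _).2 (abs_stdCDF_sub_le hβ0 hβ1 0)
  have hp : stdPDF 0 ^ 2 ≤ 1 := by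
    have := stdPDF_nonneg 0
    have := stdPDF_zero_le
    nlinarith
  have hpt : ∀ u, seriesEst K β √v u ^ 2 ≤ 3 * (1 + (scaledHermPoly √v 1).eval u ^ 2
      + N * ∑ k ∈ Finset.range N, a k ^ 2 * (scaledHermPoly √v (k + 2)).eval u ^ 2) := by
    intro u
    set T := ∑ k ∈ Finset.range N, a k * (scaledHermPoly √v (k + 2)).eval u
    have e : seriesEst K β √v u = G 0 β
        + deriv (fun w => G w β) 0 * (scaledHermPoly √v 1).eval u + stdPDF 0 * T := by
      rw [← eval_seriesEstPoly]
      simp [seriesEstPoly, Polynomial.eval_finsetSum, T, a, N]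
    have hT : T ^ 2 ≤ N * ∑ k ∈ Finset.range N,
        a k ^ 2 * (scaledHermPoly √v (k + 2)).eval u ^ 2 := by
      have := sq_sum_le_card_mul_sum_sq (s := Finset.range N)
        (f := fun k => a k * (scaledHermPoly √v (k + 2)).eval u)
      simpa [mul_pow] using this
    have m1 := mul_le_mul_of_nonneg_right h0' (sq_nonneg ((scaledHermPoly √v 1).eval u))
    have m2 := mul_le_mul_of_nonneg_right hp (sq_nonneg T)
    rw [e]
    set A := G 0 β
    set B := deriv (fun w => G w β) 0 * (scaledHermPoly √v 1).eval u with hB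
    set D := stdPDF 0 * T with hD
    have m3 : B ^ 2 ≤ (scaledHermPoly √v 1).eval u ^ 2 := by rw [hB, mul_pow]; linarith
    have m4 : D ^ 2 ≤ T ^ 2 := by rw [hD, mul_pow]; linarith
    nlinarith [sq_nonneg (A - B), sq_nonneg (A - D), sq_nonneg (B - D)]
  have hsumi : Integrable (fun u => ∑ k ∈ Finset.range N, a k ^ 2
      * (scaledHermPoly √v (k + 2)).eval u ^ 2) (gaussianReal w v) :=
    integrable_finsetSum _ fun k _ => (hQi _).const_mul _
  have h1i : Integrable (fun u => 1 + (scaledHermPoly √v 1).eval u ^ 2) (gaussianReal w v) :=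
    (integrable_const 1).add (hQi 1)
  have hb : Integrable (fun u => 1 + (scaledHermPoly √v 1).eval u ^ 2
      + N * ∑ k ∈ Finset.range N, a k ^ 2 * (scaledHermPoly √v (k + 2)).eval u ^ 2)
      (gaussianReal w v) := h1i.add (hsumi.const_mul _)
  have hSi : Integrable (fun u => seriesEst K β √v u ^ 2) (gaussianReal w v) := by
    simpa only [eval_seriesEstPoly] using
      (memLp_eval_gaussianReal w v (seriesEstPoly K β √v)).integrable_sq
  refine (integral_mono hSi (hb.const_mul 3) hpt).trans ?_
  rw [integral_const_mul, integral_add h1i (hsumi.const_mul _),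
    integral_add (integrable_const 1) (hQi 1), integral_const_mul,
    integral_finsetSum _ fun k _ => (hQi _).const_mul _]
  simp only [integral_const_mul]
  have hQ1 := integral_scaledHermPoly_sq_le w hv 1
  have hsum : ∑ k ∈ Finset.range N, a k ^ 2
      * ∫ u, (scaledHermPoly √v (k + 2)).eval u ^ 2 ∂(gaussianReal w v) ≤ N * E := by
    refine (Finset.sum_le_sum fun k _ => ha k).trans ?_
    simp
  have hfin : (N : ℝ) * ∑ k ∈ Finset.range N, a k ^ 2
      * ∫ u, (scaledHermPoly √v (k + 2)).eval u ^ 2 ∂(gaussianReal w v) ≤ K ^ 2 * E := by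
    calc _ ≤ (N : ℝ) * (N * E) := by gcongr
      _ ≤ K * (K * E) := by gcongr
      _ = _ := by ring
  simp only [integral_const, probReal_univ, smul_eq_mul, one_mul, Nat.factorial_one,
    Nat.cast_one] at *
  nlinarith [sq_nonneg (K : ℝ)]

/-- If `w ≤ -lam/2`, then `posPart w ≤ exp(-w²/2)` suffices. Otherwise `y = w + lam ≥ lam/2`, and
the tail `exp(-5 y²/2)` of a Gaussian with variance at most `1/5` outweighs `posPart w ≤ 2 exp(y²)`,
even squared. -/
theorem posPart_mul_tail_le {lam w p : ℝ} (hlam : 0 ≤ lam) (hp0 : 0 ≤ p) (hp1 : p ≤ 1)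
    (hp : 0 ≤ w + lam → p ≤ Real.exp (-(5 / 2 * (w + lam) ^ 2))) :
    posPart w * p ≤ 2 * Real.exp (-(lam ^ 2 / 8)) ∧ posPart w ^ 2 * p ≤ 4 := by
  have h0 := posPart_nonneg w
  rcases le_total w (-(lam / 2)) with hw | hw
  · have h1 := posPart_le_exp (w := w) (by linarith)
    have h2 : Real.exp (-(w ^ 2 / 2)) ≤ Real.exp (-(lam ^ 2 / 8)) :=
      Real.exp_le_exp.2 (by nlinarith)
    have h3 : Real.exp (-(w ^ 2 / 2)) ≤ 1 := Real.exp_le_one_iff.2 (by nlinarith [sq_nonneg w])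
    have h4 := Real.exp_pos (-(lam ^ 2 / 8))
    constructor
    · calc posPart w * p ≤ Real.exp (-(lam ^ 2 / 8)) * 1 := by gcongr; exact h1.trans h2
        _ ≤ _ := by linarith
    · calc posPart w ^ 2 * p ≤ 1 ^ 2 * 1 := by gcongr; exact h1.trans h3
        _ ≤ 4 := by norm_num
  · set y := w + lam with hy
    have hy0 : 0 ≤ y := by linarith
    have hwy : |w| ≤ y := abs_le.2 ⟨by linarith, by linarith⟩
    have h1 : posPart w ≤ 2 * Real.exp (y ^ 2) := by
      have := posPart_le w
      have := Real.add_one_le_exp (y ^ 2)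
      nlinarith [sq_nonneg (y - 1)]
    constructor
    · calc posPart w * p ≤ 2 * Real.exp (y ^ 2) * Real.exp (-(5 / 2 * y ^ 2)) := by
            gcongr; exact hp hy0
        _ = 2 * Real.exp (-(3 / 2 * y ^ 2)) := by
            rw [mul_assoc, ← Real.exp_add]; congr 2; ring
        _ ≤ 2 * Real.exp (-(lam ^ 2 / 8)) := by
            gcongr; nlinarith
    · calc posPart w ^ 2 * p ≤ (2 * Real.exp (y ^ 2)) ^ 2 * Real.exp (-(5 / 2 * y ^ 2)) := by
            gcongr; exact hp hy0
        _ = 4 * Real.exp (-(1 / 2 * y ^ 2)) := by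
            rw [mul_pow, ← Real.exp_nat_mul, mul_assoc, ← Real.exp_add]
            norm_num; ring
        _ ≤ 4 := by
            have : Real.exp (-(1 / 2 * y ^ 2)) ≤ 1 :=
              Real.exp_le_one_iff.2 (by nlinarith [sq_nonneg y])
            linarith


theorem abs_truncSeriesEst_le (n K : ℕ) (β s u : ℝ) :
    |truncSeriesEst n K β s u| ≤ |seriesEst K β s u| := by
  have hn : (0 : ℝ) ≤ n := n.cast_nonneg
  unfold truncSeriesEst
  generalize seriesEst K β s u = S
  rcases le_total S n with h1 | h1 <;> rcases le_total (-(n : ℝ)) S with h2 | h2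
  · rw [min_eq_left h1, max_eq_right h2]
  · rw [min_eq_left h1, max_eq_left h2, abs_neg, abs_of_nonneg hn, abs_of_nonpos (by linarith)]
    linarith
  · rw [min_eq_right h1, max_eq_right (by linarith), abs_of_nonneg hn, abs_of_nonneg (by linarith)]
    exact h1
  · rw [min_eq_right h1, max_eq_right (by linarith), abs_of_nonneg hn, abs_of_nonneg (by linarith)]
    exact h1

theorem abs_truncSeriesEst_le_natCast (n K : ℕ) (β s u : ℝ) : |truncSeriesEst n K β s u| ≤ n := by
  have hn : (0 : ℝ) ≤ n := n.cast_nonneg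
  exact abs_le.2 ⟨le_max_left _ _, max_le (by linarith) (min_le_right _ _)⟩

/-- The truncation error is zero unless `|S| > n`, where it is at most `|S| ≤ S²/n`. Thus the second
moment controls the bias due to truncation. -/
theorem abs_truncSeriesEst_sub_le {n : ℕ} (hn : 1 ≤ n) (K : ℕ) (β s u : ℝ) :
    |truncSeriesEst n K β s u - seriesEst K β s u| ≤ seriesEst K β s u ^ 2 / n := by
  have hn : (1 : ℝ) ≤ n := by exact_mod_cast hn
  rw [le_div_iff₀ (by linarith)]
  unfold truncSeriesEst
  generalize seriesEst K β s u = S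
  rcases le_total S n with h1 | h1 <;> rcases le_total (-(n : ℝ)) S with h2 | h2
  · rw [min_eq_left h1, max_eq_right h2]
    simpa using sq_nonneg S
  · rw [min_eq_left h1, max_eq_left h2, abs_of_nonneg (by linarith)]
    nlinarith
  · rw [min_eq_right h1, max_eq_right (by linarith), abs_of_nonpos (by linarith)]
    nlinarith
  · rw [min_eq_right h1, max_eq_right (by linarith), abs_of_nonpos (by linarith)]
    nlinarith

theorem memLp_seriesEst (K : ℕ) (β s w : ℝ) (v : ℝ≥0) :
    MemLp (seriesEst K β s) 2 (gaussianReal w v) := by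
  simpa only [eval_seriesEstPoly] using memLp_eval_gaussianReal w v (seriesEstPoly K β s)

theorem continuous_seriesEst (K : ℕ) (β s : ℝ) : Continuous (seriesEst K β s) := by
  have h := (seriesEstPoly K β s).continuous
  simpa only [eval_seriesEstPoly] using! h

theorem continuous_truncSeriesEst (n K : ℕ) (β s : ℝ) : Continuous (truncSeriesEst n K β s) :=
  continuous_const.max ((continuous_seriesEst K β s).min continuous_const)

theorem memLp_truncSeriesEst (n K : ℕ) (β s w : ℝ) (v : ℝ≥0) :
    MemLp (truncSeriesEst n K β s) 2 (gaussianReal w v) :=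
  (memLp_seriesEst K β s w v).mono (continuous_truncSeriesEst n K β s).aestronglyMeasurable
    (.of_forall fun u => abs_truncSeriesEst_le n K β s u)

/-- From `M! ≥ (M/e)^M` the quotient is at most `2^(-M)`, and `log 2 > 1/2`. -/
theorem pow_div_factorial_le {x : ℝ} (hx : 0 ≤ x) {M : ℕ} (hM : Real.exp 1 * (2 * x) ≤ M) :
    x ^ M / M.factorial ≤ Real.exp (-(M / 2 : ℝ)) := by
  have h1 := Real.pow_div_factorial_le_exp (M : ℝ) (by positivity) M
  have hf : (0 : ℝ) < M.factorial := by positivity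
  rw [div_le_iff₀ hf] at h1 ⊢
  have h2 : x ^ M * (2 * Real.exp 1) ^ M ≤ (M : ℝ) ^ M := by
    rw [← mul_pow]
    exact pow_le_pow_left₀ (by positivity) (by linarith) M
  have h3 : (2 : ℝ) ^ M = Real.exp (M * Real.log 2) := by
    rw [Real.exp_nat_mul, Real.exp_log two_pos]
  have h4 : Real.exp (M / 2) ≤ (2 : ℝ) ^ M := by
    rw [h3]
    refine Real.exp_le_exp.2 ?_
    have := Real.log_two_gt_d9
    have : (0 : ℝ) ≤ M := M.cast_nonneg
    nlinarith
  rw [mul_pow, ← Real.exp_nat_mul, mul_one] at h2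
  have h5 : x ^ M * 2 ^ M ≤ M.factorial := by
    have := h2.trans h1
    have he := Real.exp_pos (M : ℝ)
    refine le_of_mul_le_mul_right ?_ he
    linarith
  rw [Real.exp_neg, inv_mul_eq_div, le_div_iff₀ (Real.exp_pos _)]
  exact (mul_le_mul_of_nonneg_left h4 (by positivity)).trans h5

/-- Taylor remainder of `G` within the range controlled by the truncation order. -/
theorem abs_G_sub_taylorG_le_exp {K : ℕ} (hK : 1 ≤ K) {lam R β w : ℝ} (hlam : 0 ≤ lam)
    (hR : lam ≤ R) (hw : |w| ≤ R) (hKR : Real.exp 1 * R ^ 2 ≤ (K - 1 : ℝ) / 2) :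
    |G w β - taylorG K β w| ≤ R ^ 2 * Real.exp (-(lam ^ 2 / 8)) := by
  have hM : (K : ℝ) - 1 ≤ 2 * (K / 2 : ℕ) := by
    have : K ≤ 2 * (K / 2) + 1 := by omega
    have : (K : ℝ) ≤ 2 * (K / 2 : ℕ) + 1 := by exact_mod_cast this
    linarith
  have hwR : w ^ 2 ≤ R ^ 2 := sq_le_sq' (by linarith [neg_abs_le w]) (by linarith [le_abs_self w])
  have hlR : lam ^ 2 ≤ R ^ 2 := pow_le_pow_left₀ hlam hR 2
  have he : 1 ≤ Real.exp 1 := Real.one_le_exp (by norm_num)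
  have h1 := pow_div_factorial_le (x := w ^ 2 / 2) (by positivity) (M := K / 2)
    (by nlinarith [sq_nonneg R])
  refine (abs_G_sub_taylorG_le hK β w).trans ?_
  refine mul_le_mul hwR (h1.trans (Real.exp_le_exp.2 ?_)) (by positivity) (by positivity)
  have : R ^ 2 ≤ Real.exp 1 * R ^ 2 := le_mul_of_one_le_left (sq_nonneg _) he
  nlinarith [sq_nonneg lam]

/-! ### Bias and mean squared error of the series, weighted by its use. -/

/-- Parameter ranges under which the threshold estimate is accurate. -/
structure GoodParams (n K : ℕ) (lam R r : ℝ) : Prop where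
  one_le_n : 1 ≤ n
  one_le_K : 1 ≤ K
  lam_nonneg : 0 ≤ lam
  lam_le : lam ≤ R
  R_sq_le : R ^ 2 ≤ 9 / 20 * Real.log n
  r_pos : 0 < r
  r_le : r ≤ 1 / 5
  gap : 12 / 5 * r * Real.log n ≤ (R - lam) ^ 2
  exp_mul_R_sq_le : Real.exp 1 * R ^ 2 ≤ (K - 1 : ℝ) / 2
  K_le : (K : ℝ) ≤ 3 * Real.log n + 3

namespace GoodParams

variable {n K : ℕ} {lam R r : ℝ} (P : GoodParams n K lam R r)

include P

theorem log_nonneg : 0 ≤ Real.log n := by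
  have := P.R_sq_le
  nlinarith [sq_nonneg R]

theorem exp_log : Real.exp (Real.log n) = n :=
  Real.exp_log (by exact_mod_cast P.one_le_n)

theorem one_add_K_sq_le : 1 + (K : ℝ) ^ 2 ≤ 10 * (1 + Real.log n) ^ 2 := by
  have h := P.K_le
  have hL := P.log_nonneg
  have h0 : (0 : ℝ) ≤ K := K.cast_nonneg
  nlinarith

theorem integral_sq_le {β : ℝ} (hβ0 : 0 ≤ β) (hβ1 : β ≤ 1) {v : ℝ≥0} (hv : (v : ℝ) ≤ r) {w : ℝ}
    (hw : |w| ≤ R) : ∫ u, seriesEst K β √v u ^ 2 ∂(gaussianReal w v)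
      ≤ 60 * (1 + Real.log n) ^ 2 * Real.exp (3 / 5 * Real.log n) := by
  refine (integral_seriesEst_sq_le K hβ0 hβ1 w (hv.trans P.r_le)).trans ?_
  have h1 := P.one_add_K_sq_le
  have hwR : w ^ 2 ≤ R ^ 2 := sq_le_sq' (by linarith [neg_abs_le w]) (by linarith [le_abs_self w])
  have h2 : Real.exp (5 / 4 * w ^ 2) ≤ Real.exp (3 / 5 * Real.log n) :=
    Real.exp_le_exp.2 (by linarith [P.R_sq_le, P.log_nonneg])
  refine mul_le_mul ?_ h2 (Real.exp_pos _).le (by positivity)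
  linarith

theorem measureReal_Icc_le {v : ℝ≥0} (hv : (v : ℝ) ≤ r) {w : ℝ} (hw : R < |w|) :
    (gaussianReal w v).real (Set.Icc (-lam) lam) ≤ Real.exp (-((|w| - lam) ^ 2 / (2 * r))) := by
  have hl := P.lam_le
  rcases le_total 0 w with h | h
  · rw [abs_of_nonneg h] at *
    refine le_trans (measureReal_mono ?_) (gaussianReal_real_le_le w P.r_pos hv (by linarith))
    intro x hx
    change x ≤ w - (w - lam)
    linarith [hx.2]
  · rw [abs_of_nonpos h] at *
    refine le_trans (measureReal_mono ?_) (gaussianReal_real_ge_le w P.r_pos hv (by linarith))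
    intro x hx
    change w + (-w - lam) ≤ x
    linarith [hx.1]

/-- Two uses of one Gaussian exponent: `gap` makes it exceed `6/5 log n`, to beat the cap `n`, and
`r ≤ 1/5` makes it quadratic in the distance to `lam`, to beat the growth of `G`. -/
theorem exponent_ge {w : ℝ} (hw : R < |w|) :
    6 / 5 * Real.log n ≤ (|w| - lam) ^ 2 / (2 * r)
      ∧ 5 / 2 * (|w| - lam) ^ 2 ≤ (|w| - lam) ^ 2 / (2 * r) := by
  have hr := P.r_pos
  have hr5 := P.r_le
  have hl := P.lam_le
  have hg := P.gap
  constructor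
  · rw [le_div_iff₀ (by linarith)]
    nlinarith
  · rw [le_div_iff₀ (by linarith)]
    nlinarith [sq_nonneg (|w| - lam)]

theorem lam_sq_le : lam ^ 2 ≤ Real.log n := by
  have := pow_le_pow_left₀ P.lam_nonneg P.lam_le 2
  linarith [P.R_sq_le, P.log_nonneg]

theorem lam_le_one_add_log : lam ≤ 1 + Real.log n := by
  have := P.lam_sq_le
  nlinarith [sq_nonneg (lam - 1)]

theorem mul_measureReal_Icc_le {v : ℝ≥0} (hv : (v : ℝ) ≤ r) {w : ℝ} (hw : R < |w|) :
    (n + (1 + |w|)) * (gaussianReal w v).real (Set.Icc (-lam) lam)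
      ≤ 4 * (1 + Real.log n) ^ 2 * Real.exp (-(Real.log n / 5)) := by
  obtain ⟨h1, h2⟩ := P.exponent_ge hw
  have hL := P.log_nonneg
  have hl := P.lam_le_one_add_log
  have hlR := P.lam_le
  have h3 := P.measureReal_Icc_le hv hw
  set p := (gaussianReal w v).real (Set.Icc (-lam) lam)
  set L := Real.log n
  set y := |w| - lam with hy
  set q := y ^ 2 / (2 * r)
  have hp0 : 0 ≤ p := measureReal_nonneg
  have hy0 : 0 ≤ y := by linarith
  have a1 : n * p ≤ Real.exp (-(L / 5)) := by
    rw [← P.exp_log]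
    calc Real.exp L * p ≤ Real.exp L * Real.exp (-q) := by gcongr
      _ = Real.exp (L - q) := by rw [← Real.exp_add]; ring_nf
      _ ≤ _ := Real.exp_le_exp.2 (by linarith)
  -- Half of the exponent is spent on each of the two lower bounds.
  have a2 : p ≤ Real.exp (-(5 / 4 * y ^ 2)) * Real.exp (-(L / 5)) := by
    refine h3.trans ?_
    rw [← Real.exp_add]
    exact Real.exp_le_exp.2 (by linarith)
  have a3 : y * Real.exp (-(5 / 4 * y ^ 2)) ≤ 1 := by
    rw [Real.exp_neg, ← div_eq_mul_inv, div_le_one (Real.exp_pos _)]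
    have := Real.add_one_le_exp (5 / 4 * y ^ 2)
    nlinarith [sq_nonneg (y - 1)]
  have a4 : Real.exp (-(5 / 4 * y ^ 2)) ≤ 1 :=
    Real.exp_le_one_iff.2 (by nlinarith [sq_nonneg y])
  have e0 := Real.exp_pos (-(L / 5))
  have a5 : (1 + |w|) * p ≤ (3 + L) * Real.exp (-(L / 5)) := by
    have hw' : |w| = lam + y := by ring
    calc (1 + |w|) * p ≤ (1 + |w|) * (Real.exp (-(5 / 4 * y ^ 2)) * Real.exp (-(L / 5))) := by
          gcongr
      _ = ((1 + lam) * Real.exp (-(5 / 4 * y ^ 2)) + y * Real.exp (-(5 / 4 * y ^ 2)))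
          * Real.exp (-(L / 5)) := by rw [hw']; ring
      _ ≤ (3 + L) * Real.exp (-(L / 5)) := by
          refine mul_le_mul_of_nonneg_right ?_ e0.le
          have := P.lam_nonneg
          nlinarith
  calc (n + (1 + |w|)) * p = n * p + (1 + |w|) * p := by ring
    _ ≤ (4 + L) * Real.exp (-(L / 5)) := by linarith
    _ ≤ _ := by gcongr; nlinarith

theorem sq_mul_measureReal_Icc_le {v : ℝ≥0} (hv : (v : ℝ) ≤ r) {w : ℝ} (hw : R < |w|) :
    (n + (1 + |w|)) ^ 2 * (gaussianReal w v).real (Set.Icc (-lam) lam)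
      ≤ 22 * (1 + Real.log n) ^ 2 * Real.exp (4 / 5 * Real.log n) := by
  obtain ⟨h1, h2⟩ := P.exponent_ge hw
  have hL := P.log_nonneg
  have hl := P.lam_le_one_add_log
  have hlR := P.lam_le
  have hl0 := P.lam_nonneg
  have h3 := P.measureReal_Icc_le hv hw
  set p := (gaussianReal w v).real (Set.Icc (-lam) lam)
  set L := Real.log n
  set y := |w| - lam with hy
  set q := y ^ 2 / (2 * r)
  have hp0 : 0 ≤ p := measureReal_nonneg
  have hy0 : 0 ≤ y := by linarith
  have a1 : (n : ℝ) ^ 2 * p ≤ Real.exp (4 / 5 * L) := by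
    rw [← P.exp_log]
    calc Real.exp L ^ 2 * p ≤ Real.exp L ^ 2 * Real.exp (-q) := by gcongr
      _ = Real.exp (2 * L - q) := by
          rw [← Real.exp_nat_mul, ← Real.exp_add]; push_cast; ring_nf
      _ ≤ _ := Real.exp_le_exp.2 (by linarith)
  have a2 : p ≤ Real.exp (-(5 / 2 * y ^ 2)) :=
    h3.trans (Real.exp_le_exp.2 (by linarith))
  have a3 : y ^ 2 * Real.exp (-(5 / 2 * y ^ 2)) ≤ 1 := by
    rw [Real.exp_neg, ← div_eq_mul_inv, div_le_one (Real.exp_pos _)]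
    have := Real.add_one_le_exp (5 / 2 * y ^ 2)
    nlinarith [sq_nonneg y]
  have a4 : Real.exp (-(5 / 2 * y ^ 2)) ≤ 1 :=
    Real.exp_le_one_iff.2 (by nlinarith [sq_nonneg y])
  have a5 : (1 + |w|) ^ 2 * p ≤ 10 * (1 + L) ^ 2 := by
    have hw' : |w| = lam + y := by ring
    have hyw : (1 + |w|) ^ 2 ≤ 2 * (1 + lam) ^ 2 + 2 * y ^ 2 := by
      rw [hw']; nlinarith [sq_nonneg (1 + lam - y)]
    calc (1 + |w|) ^ 2 * p ≤ (2 * (1 + lam) ^ 2 + 2 * y ^ 2) * Real.exp (-(5 / 2 * y ^ 2)) := by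
          gcongr
      _ = 2 * (1 + lam) ^ 2 * Real.exp (-(5 / 2 * y ^ 2))
          + 2 * (y ^ 2 * Real.exp (-(5 / 2 * y ^ 2))) := by ring
      _ ≤ 2 * (1 + lam) ^ 2 * 1 + 2 * 1 := by gcongr
      _ ≤ 2 * (2 + L) ^ 2 + 2 := by
          have : (1 + lam) ^ 2 ≤ (2 + L) ^ 2 := pow_le_pow_left₀ (by linarith) (by linarith) 2
          linarith
      _ ≤ 10 * (1 + L) ^ 2 := by nlinarith
  have e1 : 1 ≤ Real.exp (4 / 5 * L) := Real.one_le_exp (by positivity)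
  have e2 : (1 : ℝ) ≤ (1 + L) ^ 2 := by nlinarith
  calc (n + (1 + |w|)) ^ 2 * p ≤ 2 * (n ^ 2 * p) + 2 * ((1 + |w|) ^ 2 * p) := by
        nlinarith [mul_nonneg (sq_nonneg ((n : ℝ) - (1 + |w|))) hp0]
    _ ≤ 2 * (1 * Real.exp (4 / 5 * L)) + 2 * (10 * (1 + L) ^ 2 * 1) := by linarith
    _ ≤ 2 * ((1 + L) ^ 2 * Real.exp (4 / 5 * L))
        + 2 * (10 * (1 + L) ^ 2 * Real.exp (4 / 5 * L)) := by gcongr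
    _ = _ := by ring

/-- Bias of the truncated series estimate, weighted by the probability that it is used. -/
theorem abs_integral_trunc_sub_mul_le {β : ℝ} (hβ0 : 0 ≤ β) (hβ1 : β ≤ 1) {v : ℝ≥0}
    (hv : (v : ℝ) ≤ r) (w : ℝ) :
    |∫ u, truncSeriesEst n K β √v u ∂(gaussianReal w v) - G w β|
        * (gaussianReal w v).real (Set.Icc (-lam) lam)
      ≤ 61 * (1 + Real.log n) ^ 2
        * (Real.exp (-(lam ^ 2 / 8)) + Real.exp (-(Real.log n / 5))) := by
  have hL := P.log_nonneg
  have hp0 : 0 ≤ (gaussianReal w v).real (Set.Icc (-lam) lam) := measureReal_nonneg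
  have hp1 : (gaussianReal w v).real (Set.Icc (-lam) lam) ≤ 1 := measureReal_le_one
  have ea := Real.exp_pos (-(lam ^ 2 / 8))
  have eb := Real.exp_pos (-(Real.log n / 5))
  have hti := (memLp_truncSeriesEst n K β √v w v).integrable one_le_two
  have hsi := (memLp_seriesEst K β √v w v).integrable one_le_two
  have hs2 := (memLp_seriesEst K β √v w v).integrable_sq
  have hn : (0 : ℝ) < n := by exact_mod_cast P.one_le_n
  rcases le_or_gt |w| R with hw | hw
  -- Truncation contributes at most `n^(3/5 - 1)` up to logarithms; the Taylor remainder is added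
  -- afterwards.
  · have b1 : |∫ u, truncSeriesEst n K β √v u ∂(gaussianReal w v)
        - ∫ u, seriesEst K β √v u ∂(gaussianReal w v)|
        ≤ 60 * (1 + Real.log n) ^ 2 * Real.exp (-(Real.log n / 5)) := by
      rw [← integral_sub hti hsi]
      refine abs_integral_le_integral_abs.trans ?_
      refine (integral_mono (hti.sub hsi).abs (hs2.div_const n)
        (fun u => abs_truncSeriesEst_sub_le P.one_le_n K β _ u)).trans ?_
      rw [integral_div, div_le_iff₀ hn]
      refine (P.integral_sq_le hβ0 hβ1 hv hw).trans ?_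
      rw [mul_assoc _ (Real.exp _) (n : ℝ)]
      refine mul_le_mul_of_nonneg_left ?_ (by positivity)
      nth_rewrite 3 [← P.exp_log]
      rw [← Real.exp_add]
      exact Real.exp_le_exp.2 (by linarith)
    rw [integral_seriesEst] at b1
    have b2 := abs_G_sub_taylorG_le_exp (β := β) P.one_le_K P.lam_nonneg P.lam_le hw
      P.exp_mul_R_sq_le
    rw [abs_sub_comm] at b2
    have b3 : R ^ 2 ≤ (1 + Real.log n) ^ 2 := by nlinarith [P.R_sq_le]
    have b4 : R ^ 2 * Real.exp (-(lam ^ 2 / 8))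
        ≤ (1 + Real.log n) ^ 2 * Real.exp (-(lam ^ 2 / 8)) := by gcongr
    have b5 := abs_sub_le (∫ u, truncSeriesEst n K β √v u ∂(gaussianReal w v)) (taylorG K β w)
      (G w β)
    refine (mul_le_of_le_one_right (abs_nonneg _) hp1).trans ?_
    have := mul_nonneg (sq_nonneg (1 + Real.log n)) ea.le
    have := mul_nonneg (sq_nonneg (1 + Real.log n)) eb.le
    linarith
  -- Here the series need not be accurate: the cap `n` and the linear growth of `G` are multiplied
  -- by the small probability of `[-lam, lam]`.
  · have b1 : |∫ u, truncSeriesEst n K β √v u ∂(gaussianReal w v)| ≤ n := by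
      have := norm_integral_le_of_norm_le_const (μ := gaussianReal w v)
        (f := truncSeriesEst n K β √v) (C := n)
        (.of_forall fun u => abs_truncSeriesEst_le_natCast n K β _ u)
      simpa using this
    have b2 := abs_G_le hβ0 hβ1 w
    have b3 := abs_sub (∫ u, truncSeriesEst n K β √v u ∂(gaussianReal w v)) (G w β)
    have b4 := mul_le_mul_of_nonneg_right (b3.trans (add_le_add b1 b2)) hp0
    have b5 := P.mul_measureReal_Icc_le hv hw
    have := mul_nonneg (sq_nonneg (1 + Real.log n)) ea.le
    have := mul_nonneg (sq_nonneg (1 + Real.log n)) eb.le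
    linarith

/-- Mean squared error of the truncated series estimate, weighted by the probability that it is
used. -/
theorem integral_trunc_sub_sq_mul_le {β : ℝ} (hβ0 : 0 ≤ β) (hβ1 : β ≤ 1) {v : ℝ≥0}
    (hv : (v : ℝ) ≤ r) (w : ℝ) :
    (∫ u, (truncSeriesEst n K β √v u - G w β) ^ 2 ∂(gaussianReal w v))
        * (gaussianReal w v).real (Set.Icc (-lam) lam)
      ≤ 124 * (1 + Real.log n) ^ 2 * Real.exp (4 / 5 * Real.log n) := by
  have hL := P.log_nonneg
  have hp0 : 0 ≤ (gaussianReal w v).real (Set.Icc (-lam) lam) := measureReal_nonneg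
  have hp1 : (gaussianReal w v).real (Set.Icc (-lam) lam) ≤ 1 := measureReal_le_one
  have hti := ((memLp_truncSeriesEst n K β √v w v).sub (memLp_const (G w β))).integrable_sq
  have hs2 := (memLp_seriesEst K β √v w v).integrable_sq
  have e1 : 1 ≤ Real.exp (4 / 5 * Real.log n) := Real.one_le_exp (by positivity)
  have e2 : Real.exp (3 / 5 * Real.log n) ≤ Real.exp (4 / 5 * Real.log n) :=
    Real.exp_le_exp.2 (by linarith)
  have hG := abs_G_le hβ0 hβ1 w
  rcases le_or_gt |w| R with hw | hw
  · have b1 : ∫ u, (truncSeriesEst n K β √v u - G w β) ^ 2 ∂(gaussianReal w v)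
        ≤ 2 * ∫ u, seriesEst K β √v u ^ 2 ∂(gaussianReal w v) + 2 * G w β ^ 2 := by
      have : ∫ u, (2 * seriesEst K β √v u ^ 2 + 2 * G w β ^ 2) ∂(gaussianReal w v)
          = 2 * ∫ u, seriesEst K β √v u ^ 2 ∂(gaussianReal w v) + 2 * G w β ^ 2 := by
        rw [integral_add (hs2.const_mul 2) (integrable_const _), integral_const_mul]
        simp
      rw [← this]
      refine integral_mono hti ((hs2.const_mul 2).add (integrable_const _)) fun u => ?_
      have h := sq_le_sq.2 (abs_truncSeriesEst_le n K β √v u)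
      change (truncSeriesEst n K β √v u - G w β) ^ 2 ≤ _
      nlinarith [sq_nonneg (truncSeriesEst n K β √v u + G w β)]
    have b2 := P.integral_sq_le hβ0 hβ1 hv hw
    have b3 : G w β ^ 2 ≤ 2 * (1 + Real.log n) ^ 2 := by
      have h1 : G w β ^ 2 ≤ (1 + R) ^ 2 := sq_le_sq' (by linarith [neg_abs_le (G w β)])
        (by linarith [le_abs_self (G w β)])
      nlinarith [P.R_sq_le, sq_nonneg (R - 1)]
    refine (mul_le_of_le_one_right (integral_nonneg fun _ => sq_nonneg _) hp1).trans ?_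
    have b4 := mul_le_mul_of_nonneg_left e1 (sq_nonneg (1 + Real.log n))
    have b5 := mul_le_mul_of_nonneg_left e2 (sq_nonneg (1 + Real.log n))
    linarith
  · have b1 : ∫ u, (truncSeriesEst n K β √v u - G w β) ^ 2 ∂(gaussianReal w v)
        ≤ (n + (1 + |w|)) ^ 2 := by
      have : ∫ _u, ((n : ℝ) + (1 + |w|)) ^ 2 ∂(gaussianReal w v) = (n + (1 + |w|)) ^ 2 := by simp
      rw [← this]
      refine integral_mono hti (integrable_const _) fun u => ?_
      have h := abs_truncSeriesEst_le_natCast n K β √v u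
      have h2 := (abs_sub (truncSeriesEst n K β √v u) (G w β)).trans (add_le_add h hG)
      exact sq_le_sq.2 (h2.trans (le_abs_self _))
    have b2 := P.sq_mul_measureReal_Icc_le hv hw
    have b4 := mul_le_mul_of_nonneg_right b1 hp0
    have : 0 ≤ (1 + Real.log n) ^ 2 * Real.exp (4 / 5 * Real.log n) := by positivity
    linarith

end GoodParams


/-! ### The full threshold estimate on an independent pair. -/

/-- The threshold estimate as a function of the pair `(U, V)`. -/
noncomputable def pairEst (n K : ℕ) (lam β s : ℝ) : ℝ × ℝ → ℝ :=
  select lam (fun u => -β * u) (fun u => (1 - β) * u) (truncSeriesEst n K β s)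

theorem select_comp (F : ℝ → ℝ) (lam : ℝ) (f₁ f₂ f₃ : ℝ → ℝ) (p : ℝ × ℝ) :
    F (select lam f₁ f₂ f₃ p)
      = select lam (fun u => F (f₁ u)) (fun u => F (f₂ u)) (fun u => F (f₃ u)) p := by
  unfold select
  split_ifs <;> rfl

theorem measurable_pairEst (n K : ℕ) (lam β s : ℝ) : Measurable (pairEst n K lam β s) := by
  have h := (continuous_truncSeriesEst n K β s).measurable
  unfold pairEst select
  refine Measurable.ite (measurableSet_lt (by fun_prop) (by fun_prop)) (by fun_prop) ?_
  exact Measurable.ite (measurableSet_lt (by fun_prop) (by fun_prop)) (by fun_prop)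
    (h.comp measurable_fst)

theorem memLp_const_mul_id (a w : ℝ) (v : ℝ≥0) :
    MemLp (fun u : ℝ => a * u) 2 (gaussianReal w v) := by
  have := memLp_eval_gaussianReal w v (Polynomial.C a * Polynomial.X)
  simpa using! this

theorem memLp_pairEst (n K : ℕ) {lam : ℝ} (hlam : 0 ≤ lam) (β s w : ℝ) (v : ℝ≥0) :
    MemLp (pairEst n K lam β s) 2 ((gaussianReal w v).prod (gaussianReal w v)) := by
  refine (memLp_two_iff_integrable_sq (measurable_pairEst n K lam β s).aestronglyMeasurable).2 ?_
  have := integrable_select (μ := gaussianReal w v) (ν := gaussianReal w v) hlam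
    (memLp_const_mul_id (-β) w v).integrable_sq (memLp_const_mul_id (1 - β) w v).integrable_sq
    (memLp_truncSeriesEst n K β s w v).integrable_sq
  exact this.congr (.of_forall fun p => (select_comp (· ^ 2) lam _ _ _ p).symm)

/-- Mean squared deviation of an affine estimate. -/
theorem integral_affine_sq_le {a g : ℝ} (ha0 : 0 ≤ a) (ha1 : a ≤ 1) (w : ℝ) {v : ℝ≥0}
    (hv : (v : ℝ) ≤ 1) :
    ∫ u, (a * (u - w) + g) ^ 2 ∂(gaussianReal w v) ≤ 2 + 2 * g ^ 2 := by
  have hvar : ∫ u, (u - w) ^ 2 ∂(gaussianReal w v) = v := by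
    have h := variance_fun_id_gaussianReal (μ := w) (v := v)
    rw [variance_eq_integral (by fun_prop)] at h
    simpa using h
  have hi : Integrable (fun u => (u - w) ^ 2) (gaussianReal w v) := by
    have := integrable_eval_gaussianReal w v ((Polynomial.X - Polynomial.C w) ^ 2)
    exact this.congr (.of_forall fun x => by simp)
  have hi2 : Integrable (fun u => (a * (u - w) + g) ^ 2) (gaussianReal w v) := by
    have := integrable_eval_gaussianReal w v
      ((Polynomial.C a * (Polynomial.X - Polynomial.C w) + Polynomial.C g) ^ 2)
    exact this.congr (.of_forall fun x => by simp)
  calc ∫ u, (a * (u - w) + g) ^ 2 ∂(gaussianReal w v)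
      ≤ ∫ u, (2 * (u - w) ^ 2 + 2 * g ^ 2) ∂(gaussianReal w v) := by
        refine integral_mono hi2 ((hi.const_mul 2).add (integrable_const _)) fun u => ?_
        have : a ^ 2 ≤ 1 := by nlinarith
        have := mul_le_mul_of_nonneg_right this (sq_nonneg (u - w))
        simp only
        nlinarith [sq_nonneg (a * (u - w) - g)]
    _ = 2 * v + 2 * g ^ 2 := by
        rw [integral_add (hi.const_mul 2) (integrable_const _), integral_const_mul, hvar]
        simp
    _ ≤ _ := by linarith

namespace GoodParams

variable {n K : ℕ} {lam R r : ℝ} (P : GoodParams n K lam R r)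

include P

theorem posPart_mul_Iio_le {v : ℝ≥0} (hv : (v : ℝ) ≤ r) (w : ℝ) :
    posPart w * (gaussianReal w v).real (Set.Iio (-lam)) ≤ 2 * Real.exp (-(lam ^ 2 / 8))
      ∧ posPart w ^ 2 * (gaussianReal w v).real (Set.Iio (-lam)) ≤ 4 := by
  refine posPart_mul_tail_le P.lam_nonneg measureReal_nonneg measureReal_le_one fun h => ?_
  refine (measureReal_mono ?_).trans ((gaussianReal_real_le_le w (r := 1 / 5) (by norm_num)
    (hv.trans P.r_le) h).trans (Real.exp_le_exp.2 (le_of_eq (by ring))))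
  intro x (hx : x < -lam)
  change x ≤ w - (w + lam)
  linarith

theorem posPart_neg_mul_Ioi_le {v : ℝ≥0} (hv : (v : ℝ) ≤ r) (w : ℝ) :
    posPart (-w) * (gaussianReal w v).real (Set.Ioi lam) ≤ 2 * Real.exp (-(lam ^ 2 / 8))
      ∧ posPart (-w) ^ 2 * (gaussianReal w v).real (Set.Ioi lam) ≤ 4 := by
  refine posPart_mul_tail_le P.lam_nonneg measureReal_nonneg measureReal_le_one fun h => ?_
  refine (measureReal_mono ?_).trans ((gaussianReal_real_ge_le w (r := 1 / 5) (by norm_num)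
    (hv.trans P.r_le) h).trans (Real.exp_le_exp.2 (le_of_eq (by ring))))
  intro x (hx : lam < x)
  change w + (-w + lam) ≤ x
  linarith

theorem abs_integral_pairEst_sub_le {β : ℝ} (hβ0 : 0 ≤ β) (hβ1 : β ≤ 1) {v : ℝ≥0}
    (hv : (v : ℝ) ≤ r) (w : ℝ) :
    |∫ p, pairEst n K lam β √v p ∂((gaussianReal w v).prod (gaussianReal w v)) - G w β|
      ≤ 65 * (1 + Real.log n) ^ 2
        * (Real.exp (-(lam ^ 2 / 8)) + Real.exp (-(Real.log n / 5))) := by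
  have hL := P.log_nonneg
  have h1 := (P.posPart_mul_Iio_le hv w).1
  have h2 := (P.posPart_neg_mul_Ioi_le hv w).1
  have h3 := P.abs_integral_trunc_sub_mul_le hβ0 hβ1 hv w
  have hsum := measureReal_add_add_eq_one (ν := gaussianReal w v) P.lam_nonneg
  have ea := Real.exp_pos (-(lam ^ 2 / 8))
  have eb := Real.exp_pos (-(Real.log n / 5))
  rw [pairEst, integral_select P.lam_nonneg ((memLp_const_mul_id (-β) w v).integrable one_le_two)
    ((memLp_const_mul_id (1 - β) w v).integrable one_le_two)
    ((memLp_truncSeriesEst n K β √v w v).integrable one_le_two), integral_const_mul,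
    integral_const_mul, integral_id_gaussianReal]
  have hpA : 0 ≤ posPart w * (gaussianReal w v).real (Set.Iio (-lam)) :=
    mul_nonneg (posPart_nonneg _) measureReal_nonneg
  have hpB : 0 ≤ posPart (-w) * (gaussianReal w v).real (Set.Ioi lam) :=
    mul_nonneg (posPart_nonneg _) measureReal_nonneg
  have hp : 0 ≤ (gaussianReal w v).real (Set.Icc (-lam) lam) := measureReal_nonneg
  have g1 := G_eq_posPart w β
  have g2 := G_eq_posPart_neg w β
  set m := ∫ u, truncSeriesEst n K β √v u ∂(gaussianReal w v)
  set pA := (gaussianReal w v).real (Set.Iio (-lam))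
  set pB := (gaussianReal w v).real (Set.Ioi lam)
  set pC := (gaussianReal w v).real (Set.Icc (-lam) lam)
  -- Because the three probabilities sum to one, `G` can be subtracted within each region, leaving
  -- the error of the branch used there.
  have e : -β * w * pA + (1 - β) * w * pB + m * pC - G w β
      = -(posPart w * pA) + -(posPart (-w) * pB) + (m - G w β) * pC := by
    linear_combination G w β * hsum - g1 * pA - g2 * pB
  rw [e]
  have t1 := abs_add_le (-(posPart w * pA) + -(posPart (-w) * pB)) ((m - G w β) * pC)
  have t2 := abs_add_le (-(posPart w * pA)) (-(posPart (-w) * pB))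
  rw [abs_neg, abs_neg, abs_of_nonneg hpA, abs_of_nonneg hpB] at t2
  rw [abs_mul, abs_of_nonneg hp] at t1
  have h4 : (1 : ℝ) ≤ (1 + Real.log n) ^ 2 := by nlinarith
  have h5 := mul_le_mul_of_nonneg_right h4 ea.le
  have h6 := mul_nonneg (sq_nonneg (1 + Real.log n)) eb.le
  linarith

theorem integral_pairEst_sub_sq_le {β : ℝ} (hβ0 : 0 ≤ β) (hβ1 : β ≤ 1) {v : ℝ≥0}
    (hv : (v : ℝ) ≤ r) (w : ℝ) :
    ∫ p, (pairEst n K lam β √v p - G w β) ^ 2 ∂((gaussianReal w v).prod (gaussianReal w v))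
      ≤ 144 * (1 + Real.log n) ^ 2 * Real.exp (4 / 5 * Real.log n) := by
  have hL := P.log_nonneg
  have hv1 : (v : ℝ) ≤ 1 := by linarith [P.r_le]
  have h1 := (P.posPart_mul_Iio_le hv w).2
  have h2 := (P.posPart_neg_mul_Ioi_le hv w).2
  have h3 := P.integral_trunc_sub_sq_mul_le hβ0 hβ1 hv w
  have hc : MemLp (fun _ : ℝ => G w β) 2 (gaussianReal w v) := memLp_const _
  simp only [pairEst, select_comp (fun x => (x - G w β) ^ 2)]
  have i1 : Integrable (fun u => (-β * u - G w β) ^ 2) (gaussianReal w v) :=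
    ((memLp_const_mul_id (-β) w v).sub hc).integrable_sq
  have i2 : Integrable (fun u => ((1 - β) * u - G w β) ^ 2) (gaussianReal w v) :=
    ((memLp_const_mul_id (1 - β) w v).sub hc).integrable_sq
  have i3 : Integrable (fun u => (truncSeriesEst n K β √v u - G w β) ^ 2) (gaussianReal w v) :=
    ((memLp_truncSeriesEst n K β √v w v).sub hc).integrable_sq
  rw [integral_select P.lam_nonneg i1 i2 i3]
  have e1 : ∫ u, (-β * u - G w β) ^ 2 ∂(gaussianReal w v) ≤ 2 + 2 * posPart w ^ 2 := by
    refine le_trans (le_of_eq ?_) (integral_affine_sq_le (g := posPart w) hβ0 hβ1 w hv1)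
    congr 1 with u
    rw [G_eq_posPart]; ring
  have e2 : ∫ u, ((1 - β) * u - G w β) ^ 2 ∂(gaussianReal w v) ≤ 2 + 2 * posPart (-w) ^ 2 := by
    refine le_trans (le_of_eq ?_) ((integral_affine_sq_le (g := -posPart (-w))
      (sub_nonneg.2 hβ1) (sub_le_self 1 hβ0) w hv1).trans_eq (by rw [neg_sq]))
    congr 1 with u
    rw [G_eq_posPart_neg]; ring
  have p1 : (gaussianReal w v).real (Set.Iio (-lam)) ≤ 1 := measureReal_le_one
  have p2 : (gaussianReal w v).real (Set.Ioi lam) ≤ 1 := measureReal_le_one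
  have e3 := mul_le_mul_of_nonneg_right e1
    (measureReal_nonneg (μ := gaussianReal w v) (s := Set.Iio (-lam)))
  have e4 := mul_le_mul_of_nonneg_right e2
    (measureReal_nonneg (μ := gaussianReal w v) (s := Set.Ioi lam))
  have h4 : (1 : ℝ) ≤ (1 + Real.log n) ^ 2 := by nlinarith
  have h5 : 1 ≤ Real.exp (4 / 5 * Real.log n) := Real.one_le_exp (by positivity)
  have h6 := one_le_mul_of_one_le_of_one_le h4 h5
  linarith

end GoodParams

/-! ### Splitting one observation into two independent ones. -/

/-- Sum and difference of independent Gaussians with equal variances are independent. -/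
theorem map_add_sub_gaussianReal (θ : ℝ) (σ : ℝ≥0) :
    ((gaussianReal θ σ).prod (gaussianReal 0 σ)).map (fun p => (p.1 + p.2, p.1 - p.2))
      = (gaussianReal θ (2 * σ)).prod (gaussianReal θ (2 * σ)) := by
  set P := (gaussianReal θ σ).prod (gaussianReal 0 σ) with hP
  have hf : P.map Prod.fst = gaussianReal θ σ := by simp [hP]
  have hs : P.map Prod.snd = gaussianReal 0 σ := by simp [hP]
  have hind : IndepFun (Prod.fst : ℝ × ℝ → ℝ) Prod.snd P := by
    rw [indepFun_iff_map_prod_eq_prod_map_map measurable_fst.aemeasurable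
      measurable_snd.aemeasurable, hf, hs]
    exact Measure.map_id
  have hg : HasGaussianLaw (fun p : ℝ × ℝ => (p.1, p.2)) P :=
    (IsGaussian.hasGaussianLaw_id (μ := P))
  have hg' : HasGaussianLaw (fun p : ℝ × ℝ => (p.1 + p.2, p.1 - p.2)) P :=
    hg.map_fun ((ContinuousLinearMap.fst ℝ ℝ ℝ + ContinuousLinearMap.snd ℝ ℝ ℝ).prod
      (ContinuousLinearMap.fst ℝ ℝ ℝ - ContinuousLinearMap.snd ℝ ℝ ℝ))
  have hf2 : MemLp (Prod.fst : ℝ × ℝ → ℝ) 2 P := hg.fst.memLp_two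
  have hs2 : MemLp (Prod.snd : ℝ × ℝ → ℝ) 2 P := hg.snd.memLp_two
  have v1 : Var[(Prod.fst : ℝ × ℝ → ℝ); P] = σ := by
    have := variance_map (μ := P) (X := id) (Y := Prod.fst) (by fun_prop) (by fun_prop)
    rw [hf, variance_id_gaussianReal] at this
    exact this.symm
  have v2 : Var[(Prod.snd : ℝ × ℝ → ℝ); P] = σ := by
    have := variance_map (μ := P) (X := id) (Y := Prod.snd) (by fun_prop) (by fun_prop)
    rw [hs, variance_id_gaussianReal] at this
    exact this.symm
  -- The two variances `σ` cancel, and joint Gaussianity turns zero covariance into independence.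
  have hcov : cov[(Prod.fst + Prod.snd : ℝ × ℝ → ℝ), Prod.fst - Prod.snd; P] = 0 := by
    rw [covariance_add_left hf2 hs2 (hf2.sub hs2), covariance_sub_right hf2 hf2 hs2,
      covariance_sub_right hs2 hf2 hs2, covariance_self (by fun_prop),
      covariance_self (by fun_prop), v1, v2, hind.covariance_eq_zero hf2 hs2,
      covariance_comm, hind.covariance_eq_zero hf2 hs2]
    ring
  have hind' : IndepFun (Prod.fst + Prod.snd : ℝ × ℝ → ℝ) (Prod.fst - Prod.snd) P :=
    HasGaussianLaw.indepFun_of_covariance_eq_zero hg' hcov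
  have l1 : P.map (Prod.fst + Prod.snd : ℝ × ℝ → ℝ) = gaussianReal θ (2 * σ) := by
    rw [gaussianReal_add_gaussianReal_of_indepFun hind hf hs, add_zero, two_mul]
  have l2 : P.map (Prod.fst - Prod.snd : ℝ × ℝ → ℝ) = gaussianReal θ (2 * σ) := by
    have hn : P.map (fun p : ℝ × ℝ => -p.2) = gaussianReal 0 σ := by
      have h := Measure.map_map (μ := P) (g := fun x : ℝ => -x) (f := Prod.snd) measurable_neg
        measurable_snd
      rw [hs, gaussianReal_map_neg, neg_zero] at h
      exact h.symm
    have hi : IndepFun (Prod.fst : ℝ × ℝ → ℝ) (fun p => -p.2) P :=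
      hind.comp measurable_id measurable_neg
    rw [sub_eq_add_neg, two_mul]
    have := gaussianReal_add_gaussianReal_of_indepFun hi hf hn
    rw [add_zero] at this
    exact this
  have := (indepFun_iff_map_prod_eq_prod_map_map (by fun_prop) (by fun_prop)).1 hind'
  rw [l1, l2] at this
  exact this

/-- Joint law of the two noisy copies of the standardized observation. -/
theorem map_pair_eq (θ η c d : ℝ) (σ : ℝ≥0) :
    ((gaussianReal θ σ).prod (gaussianReal 0 1)).map
        (fun p => (c + d * (p.1 - η + √(σ : ℝ) * p.2), c + d * (p.1 - η - √(σ : ℝ) * p.2)))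
      = (gaussianReal (c + d * (θ - η)) (2 * σ * (d ^ 2).toNNReal)).prod
        (gaussianReal (c + d * (θ - η)) (2 * σ * (d ^ 2).toNNReal)) := by
  have hz : (gaussianReal 0 1).map (fun z => √(σ : ℝ) * z) = gaussianReal 0 σ := by
    rw [gaussianReal_map_const_mul]
    congr 1
    · simp
    · ext; simp
  have hP : ((gaussianReal θ σ).prod (gaussianReal 0 1)).map (Prod.map id (fun z => √(σ : ℝ) * z))
      = (gaussianReal θ σ).prod (gaussianReal 0 σ) := by
    rw [← Measure.map_prod_map _ _ measurable_id (by fun_prop), Measure.map_id, hz]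
  have ha : (gaussianReal θ (2 * σ)).map (fun a => c + d * (a - η))
      = gaussianReal (c + d * (θ - η)) (2 * σ * (d ^ 2).toNNReal) := by
    have h1 := gaussianReal_map_sub_const (μ := θ) (v := 2 * σ) η
    have h2 := gaussianReal_map_const_mul (μ := θ - η) (v := 2 * σ) d
    have h3 := gaussianReal_map_const_add (μ := d * (θ - η))
      (v := NNReal.mk (d ^ 2) (sq_nonneg d) * (2 * σ)) c
    have hv : NNReal.mk (d ^ 2) (sq_nonneg d) * (2 * σ) = 2 * σ * (d ^ 2).toNNReal := by
      rw [mul_comm, Real.toNNReal_of_nonneg (sq_nonneg d)]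
    rw [← h1, Measure.map_map (by fun_prop) (by fun_prop)] at h2
    rw [← h2, Measure.map_map (by fun_prop) (by fun_prop), hv, add_comm] at h3
    rw [← h3]
    rfl
  have hfun : (fun p : ℝ × ℝ =>
        (c + d * (p.1 - η + √(σ : ℝ) * p.2), c + d * (p.1 - η - √(σ : ℝ) * p.2)))
      = Prod.map (fun a => c + d * (a - η)) (fun a => c + d * (a - η))
        ∘ ((fun p : ℝ × ℝ => (p.1 + p.2, p.1 - p.2)) ∘ Prod.map id (fun z => √(σ : ℝ) * z)) := by
    ext p <;> simp only [Function.comp_apply, Prod.map_fst, Prod.map_snd, id] <;> ring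
  rw [hfun, ← Measure.map_map (by fun_prop) (by fun_prop),
    ← Measure.map_map (by fun_prop) (by fun_prop), hP, map_add_sub_gaussianReal,
    ← Measure.map_prod_map _ _ (by fun_prop) (by fun_prop), ha]


/-! ### The predictive check loss. -/

theorem integrable_id_gaussianReal (w : ℝ) (v : ℝ≥0) :
    Integrable (fun x : ℝ => x) (gaussianReal w v) := by
  simpa using integrable_eval_gaussianReal w v Polynomial.X

/-- Expected check loss of a Gaussian variable. -/
theorem integral_check_gaussianReal {b h : ℝ} (hbh : 0 < b + h) (m : ℝ) {V : ℝ≥0} (hV : V ≠ 0) :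
    ∫ t, (b * max t 0 + h * max (-t) 0) ∂(gaussianReal m V)
      = (b + h) * √(V : ℝ) * G (-m / √(V : ℝ)) (ratio b h) := by
  have hs : 0 < √(V : ℝ) := Real.sqrt_pos.2 (by exact_mod_cast pos_iff_ne_zero.2 hV)
  have hi := integrable_id_gaussianReal m V
  have hneg : ∫ t, max (-t) 0 ∂(gaussianReal m V) = √(V : ℝ)
      * (stdPDF (-m / √(V : ℝ)) + -m / √(V : ℝ) * stdCDF (-m / √(V : ℝ))) := by
    have hmap : gaussianReal m V = (gaussianReal 0 1).map (fun z => m + √(V : ℝ) * z) := by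
      have h2 := gaussianReal_map_const_mul (μ := 0) (v := 1) √(V : ℝ)
      have h3 := gaussianReal_map_const_add (μ := √(V : ℝ) * 0)
        (v := NNReal.mk (√(V : ℝ) ^ 2) (sq_nonneg _) * 1) m
      rw [← h2, Measure.map_map (by fun_prop) (by fun_prop)] at h3
      rw [show (fun z => m + √(V : ℝ) * z) = (fun x => m + x) ∘ (fun x => √(V : ℝ) * x) from rfl,
        h3]
      congr 1
      · simp
      · ext; simp
    rw [hmap, integral_map (by fun_prop) (by fun_prop), ← integral_max_sub_std,
      ← integral_const_mul]
    congr 1 with z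
    rw [mul_max_of_nonneg _ _ hs.le, mul_zero]
    congr 1
    field_simp
    ring
  -- A linear part plus a multiple of the negative part; the linear part becomes the term `-β w` of
  -- `G`.
  have e : ∀ t : ℝ, b * max t 0 + h * max (-t) 0 = b * t + (b + h) * max (-t) 0 := by
    intro t
    rcases le_total 0 t with ht | ht
    · rw [max_eq_left ht, max_eq_right (by linarith)]; ring
    · rw [max_eq_right ht, max_eq_left (by linarith)]; ring
  have hn : Integrable (fun t : ℝ => max (-t) 0) (gaussianReal m V) := hi.neg.pos_part
  simp only [e]
  rw [integral_add (hi.const_mul b) (hn.const_mul _), integral_const_mul,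
    integral_const_mul, hneg, integral_id_gaussianReal, G, ratio]
  field_simp
  ring

theorem integrable_coordLoss (b h w q : ℝ) (v : ℝ≥0) :
    Integrable (fun y => b * max (y - q) 0 + h * max (q - y) 0) (gaussianReal w v) := by
  have hi := integrable_id_gaussianReal w v
  exact ((hi.sub (integrable_const q)).pos_part.const_mul b).add
    (((integrable_const q).sub hi).pos_part.const_mul h)

theorem abs_coordLoss_sub_le {b h : ℝ} (hb : 0 < b) (hh : 0 < h) (σf : ℝ≥0) (θ q q' : ℝ) :
    |coordLoss b h σf θ q - coordLoss b h σf θ q'| ≤ (b + h) * |q - q'| := by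
  unfold coordLoss
  rw [← integral_sub (integrable_coordLoss b h θ q σf) (integrable_coordLoss b h θ q' σf)]
  have := norm_integral_le_of_norm_le_const (μ := gaussianReal θ σf) (C := (b + h) * |q - q'|)
    (f := fun y => (b * max (y - q) 0 + h * max (q - y) 0)
      - (b * max (y - q') 0 + h * max (q' - y) 0)) (.of_forall fun y => ?_)
  · simpa using this
  · have h1 := abs_max_sub_max_le_abs (y - q) (y - q') 0
    have h2 := abs_max_sub_max_le_abs (q - y) (q' - y) 0
    rw [sub_sub_sub_cancel_left, abs_sub_comm q' q] at h1
    rw [sub_sub_sub_cancel_right] at h2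
    rw [Real.norm_eq_abs]
    calc _ = |b * (max (y - q) 0 - max (y - q') 0) + h * (max (q - y) 0 - max (q' - y) 0)| := by
          congr 1; ring
      _ ≤ b * |max (y - q) 0 - max (y - q') 0| + h * |max (q - y) 0 - max (q' - y) 0| := by
          refine (abs_add_le _ _).trans (le_of_eq ?_)
          rw [abs_mul, abs_mul, abs_of_pos hb, abs_of_pos hh]
      _ ≤ b * |q - q'| + h * |q - q'| := by gcongr
      _ = _ := by ring

theorem continuous_coordLoss {b h : ℝ} (hb : 0 < b) (hh : 0 < h) (σf : ℝ≥0) (θ : ℝ) :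
    Continuous (coordLoss b h σf θ) := by
  refine (LipschitzWith.of_dist_le_mul (K := (b + h).toNNReal) fun q q' => ?_).continuous
  rw [Real.dist_eq, Real.dist_eq, Real.coe_toNNReal _ (by linarith)]
  exact abs_coordLoss_sub_le hb hh σf θ q q'

theorem map_sub_affine_gaussianReal (θ α e : ℝ) (σp σf : ℝ≥0) :
    ((gaussianReal θ σp).prod (gaussianReal θ σf)).map (fun p => p.2 - (α * p.1 + e))
      = gaussianReal (θ - (α * θ + e)) (σf + (α ^ 2).toNNReal * σp) := by
  have ha : (gaussianReal θ σp).map (fun x => -e + -α * x)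
      = gaussianReal (-(α * θ + e)) ((α ^ 2).toNNReal * σp) := by
    have h2 := gaussianReal_map_const_mul (μ := θ) (v := σp) (-α)
    have h3 := gaussianReal_map_const_add (μ := -α * θ)
      (v := NNReal.mk ((-α) ^ 2) (sq_nonneg _) * σp) (-e)
    rw [← h2, Measure.map_map (by fun_prop) (by fun_prop)] at h3
    rw [show (fun x => -e + -α * x) = (fun x => -e + x) ∘ (fun x => -α * x) from rfl, h3]
    congr 1
    · ring
    · ext; simp [Real.coe_toNNReal _ (sq_nonneg α)]
  have hc := gaussianReal_conv_gaussianReal (m₁ := -(α * θ + e)) (m₂ := θ)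
    (v₁ := (α ^ 2).toNNReal * σp) (v₂ := σf)
  rw [add_comm (-(α * θ + e)) θ, add_comm ((α ^ 2).toNNReal * σp), ← sub_eq_add_neg] at hc
  have hid : (gaussianReal θ σf).map id = gaussianReal θ σf := Measure.map_id
  rw [← hc, ← ha, Measure.conv]
  nth_rewrite 2 [← hid]
  rw [Measure.map_prod_map _ _ (by fun_prop) measurable_id,
    Measure.map_map (by fun_prop) (by fun_prop)]
  congr 1 with p
  simp only [Function.comp_apply, Prod.map_fst, Prod.map_snd, id]
  ring

/-- Expected predictive loss of an affine predictor. -/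
theorem integral_coordLoss_affine {b h : ℝ} (hbh : 0 < b + h) (θ α e : ℝ) (σp : ℝ≥0) {σf : ℝ≥0}
    (hσf : 0 < σf) :
    ∫ x, coordLoss b h σf θ (α * x + e) ∂(gaussianReal θ σp)
      = (b + h) * √(σf + σp * α ^ 2)
        * G ((α * θ + e - θ) / √(σf + σp * α ^ 2)) (ratio b h) := by
  set V : ℝ≥0 := σf + (α ^ 2).toNNReal * σp with hVdef
  have hV : V ≠ 0 := (lt_of_lt_of_le hσf le_self_add).ne'
  have hVc : (V : ℝ) = σf + σp * α ^ 2 := by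
    rw [hVdef]; push_cast; rw [Real.coe_toNNReal _ (sq_nonneg α)]; ring
  have hlaw := map_sub_affine_gaussianReal θ α e σp σf
  have key := integral_check_gaussianReal hbh (θ - (α * θ + e)) hV
  have hint : Integrable (fun t : ℝ => b * max t 0 + h * max (-t) 0)
      (gaussianReal (θ - (α * θ + e)) V) := by
    simpa using integrable_coordLoss b h (θ - (α * θ + e)) 0 V
  rw [← hlaw] at key hint
  rw [integral_map (by fun_prop) (by fun_prop)] at key
  have hint' : Integrable (fun p : ℝ × ℝ => b * max (p.2 - (α * p.1 + e)) 0
      + h * max (-(p.2 - (α * p.1 + e))) 0) ((gaussianReal θ σp).prod (gaussianReal θ σf)) :=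
    hint.comp_measurable (by fun_prop)
  rw [hVc, neg_sub] at key
  rw [← key, integral_prod _ hint']
  simp [coordLoss]

theorem memLp_coordLoss_affine {b h : ℝ} (hb : 0 < b) (hh : 0 < h) (θ α e : ℝ) (σp σf : ℝ≥0) :
    MemLp (fun x => coordLoss b h σf θ (α * x + e)) 2 (gaussianReal θ σp) := by
  have h1 : MemLp (fun x : ℝ => |coordLoss b h σf θ e| + (b + h) * |α * x|) 2
      (gaussianReal θ σp) := by
    have i1 : MemLp (fun _ : ℝ => |coordLoss b h σf θ e|) 2 (gaussianReal θ σp) := memLp_const _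
    have i2 : MemLp (fun x : ℝ => (b + h) * |α * x|) 2 (gaussianReal θ σp) :=
      (memLp_const_mul_id α θ σp).abs.const_mul _
    exact i1.add i2
  refine h1.mono ((continuous_coordLoss hb hh σf θ).comp (by fun_prop)).aestronglyMeasurable
    (.of_forall fun x => ?_)
  have h2 := abs_coordLoss_sub_le hb hh σf θ (α * x + e) e
  rw [add_sub_cancel_right] at h2
  rw [Real.norm_eq_abs, Real.norm_eq_abs]
  refine le_trans ?_ (le_abs_self _)
  have h3 := abs_sub_abs_le_abs_sub (coordLoss b h σf θ (α * x + e)) (coordLoss b h σf θ e)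
  linarith

theorem integral_coordLoss_affine_sub_sq_le {b h : ℝ} (hb : 0 < b) (hh : 0 < h) (θ e : ℝ) {α : ℝ}
    (hα0 : 0 ≤ α) (hα1 : α ≤ 1) (σp σf : ℝ≥0) :
    ∫ x, (coordLoss b h σf θ (α * x + e) - coordLoss b h σf θ (α * θ + e)) ^ 2
        ∂(gaussianReal θ σp) ≤ (b + h) ^ 2 * σp := by
  have hvar : ∫ u, (u - θ) ^ 2 ∂(gaussianReal θ σp) = σp := by
    have h := variance_fun_id_gaussianReal (μ := θ) (v := σp)
    rw [variance_eq_integral (by fun_prop)] at h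
    simpa using h
  have hi : Integrable (fun u => (u - θ) ^ 2) (gaussianReal θ σp) := by
    have := integrable_eval_gaussianReal θ σp ((Polynomial.X - Polynomial.C θ) ^ 2)
    exact this.congr (.of_forall fun x => by simp)
  rw [← hvar, ← integral_const_mul]
  refine integral_mono ((memLp_coordLoss_affine hb hh θ α e σp σf).sub
    (memLp_const _)).integrable_sq (hi.const_mul _) fun x => ?_
  have h1 := abs_coordLoss_sub_le hb hh σf θ (α * x + e) (α * θ + e)
  have h2 : |α * x + e - (α * θ + e)| ≤ |x - θ| := by
    rw [show α * x + e - (α * θ + e) = α * (x - θ) by ring, abs_mul, abs_of_nonneg hα0]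
    exact mul_le_of_le_one_left (abs_nonneg _) hα1
  have h3 : |coordLoss b h σf θ (α * x + e) - coordLoss b h σf θ (α * θ + e)|
      ≤ |(b + h) * (x - θ)| := by
    rw [abs_mul, abs_of_pos (by linarith : 0 < b + h)]
    exact h1.trans (by gcongr)
  have h4 := sq_le_sq.2 h3
  rw [mul_pow] at h4
  exact h4

/-! ### Averaging over the added noise. -/

theorem sq_integral_le_integral_sq {Ω : Type*} {mΩ : MeasurableSpace Ω} {P : Measure Ω}
    [IsProbabilityMeasure P] {f : Ω → ℝ} (hf : MemLp f 2 P) :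
    (∫ ω, f ω ∂P) ^ 2 ≤ ∫ ω, f ω ^ 2 ∂P := by
  have h := variance_nonneg f P
  rw [variance_eq_sub hf] at h
  simpa using h

section RaoBlackwell

variable {μ ρ : Measure ℝ} [IsProbabilityMeasure μ] [IsProbabilityMeasure ρ] {F : ℝ × ℝ → ℝ}

/-- Jensen's inequality on each section; only almost every section is known to be square integrable.
-/
theorem ae_sq_integral_sub_le (hF : MemLp F 2 (μ.prod ρ)) (a : ℝ) :
    ∀ᵐ x ∂μ, (∫ z, F (x, z) ∂ρ - a) ^ 2 ≤ ∫ z, (F (x, z) - a) ^ 2 ∂ρ := by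
  have h1 : ∀ᵐ x ∂μ, AEStronglyMeasurable (fun z => F (x, z)) ρ := hF.1.prodMk_left
  filter_upwards [h1, hF.integrable_sq.prod_right_ae] with x hx1 hx2
  have hx : MemLp (fun z => F (x, z)) 2 ρ := (memLp_two_iff_integrable_sq hx1).2 hx2
  have h := sq_integral_le_integral_sq (hx.sub (memLp_const a))
  have e : ∫ z, (F (x, z) - a) ∂ρ = ∫ z, F (x, z) ∂ρ - a := by
    rw [integral_sub (hx.integrable one_le_two) (integrable_const a)]; simp
  rw [← e]
  exact h

theorem memLp_integral_prod_left (hF : MemLp F 2 (μ.prod ρ)) :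
    MemLp (fun x => ∫ z, F (x, z) ∂ρ) 2 μ := by
  have hm : AEStronglyMeasurable (fun x => ∫ z, F (x, z) ∂ρ) μ := hF.1.integral_prod_right'
  refine (memLp_two_iff_integrable_sq hm).2 ?_
  refine hF.integrable_sq.integral_prod_left.mono (hm.pow 2) ?_
  filter_upwards [ae_sq_integral_sub_le hF 0] with x hx
  simp only [sub_zero] at hx
  rw [Real.norm_of_nonneg (sq_nonneg _), Real.norm_of_nonneg (integral_nonneg fun _ => sq_nonneg _)]
  exact hx

theorem integral_sq_integral_sub_le (hF : MemLp F 2 (μ.prod ρ)) (a : ℝ) :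
    ∫ x, (∫ z, F (x, z) ∂ρ - a) ^ 2 ∂μ ≤ ∫ p, (F p - a) ^ 2 ∂(μ.prod ρ) := by
  have hi : Integrable (fun p => (F p - a) ^ 2) (μ.prod ρ) :=
    (hF.sub (memLp_const a)).integrable_sq
  rw [integral_prod _ hi]
  exact integral_mono_ae ((memLp_integral_prod_left hF).sub (memLp_const a)).integrable_sq
    hi.integral_prod_left (ae_sq_integral_sub_le hF a)

end RaoBlackwell

theorem randThresholdEst_eq (n : ℕ) (b h : ℝ) (σp σf : ℝ≥0) (γ : ℝ) (τ : ℝ≥0∞) (x z : ℝ) :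
    randThresholdEst n b h σp σf γ τ x z
      = pairEst n (truncOrder n γ σp σf) (threshold n γ) (ratio b h)
        √(2 * σp * dCoef σp σf τ ^ 2)
        (cCoef b h σp σf τ + dCoef σp σf τ * (x + √(σp : ℝ) * z),
          cCoef b h σp σf τ + dCoef σp σf τ * (x - √(σp : ℝ) * z)) := rfl

/-- The mean of the predictive loss, in standardized form. -/
noncomputable def stdMean (b h : ℝ) (σp σf : ℝ≥0) (η θ : ℝ) (τ : ℝ≥0∞) : ℝ :=
  cCoef b h σp σf τ + dCoef σp σf τ * (θ - η)

/-- The common variance of the two noisy copies. -/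
noncomputable def pairVar (σp σf : ℝ≥0) (τ : ℝ≥0∞) : ℝ≥0 :=
  2 * σp * (dCoef σp σf τ ^ 2).toNNReal

theorem coe_pairVar (σp σf : ℝ≥0) (τ : ℝ≥0∞) :
    (pairVar σp σf τ : ℝ) = 2 * σp * dCoef σp σf τ ^ 2 := by
  simp [pairVar, Real.coe_toNNReal _ (sq_nonneg _)]

/-- The Rao-Blackwellized estimate inherits first and second moments from the pair estimate. -/
theorem thresholdEst_moments {n : ℕ} (b h : ℝ) (σp σf : ℝ≥0) {γ : ℝ} (hγ : 0 ≤ threshold n γ)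
    (τ : ℝ≥0∞) (η θ : ℝ) :
    let ν := gaussianReal (stdMean b h σp σf η θ τ) (pairVar σp σf τ)
    let E := pairEst n (truncOrder n γ σp σf) (threshold n γ) (ratio b h) √(pairVar σp σf τ : ℝ)
    MemLp (fun x => thresholdEst n b h σp σf γ τ (x - η)) 2 (gaussianReal θ σp)
      ∧ ∫ x, thresholdEst n b h σp σf γ τ (x - η) ∂(gaussianReal θ σp) = ∫ p, E p ∂(ν.prod ν)
      ∧ ∀ a, ∫ x, (thresholdEst n b h σp σf γ τ (x - η) - a) ^ 2 ∂(gaussianReal θ σp)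
        ≤ ∫ p, (E p - a) ^ 2 ∂(ν.prod ν) := by
  intro ν E
  have hE2 : MemLp E 2 (ν.prod ν) := memLp_pairEst n _ hγ _ _ _ _
  have hEm : Measurable E := measurable_pairEst _ _ _ _ _
  set φ : ℝ × ℝ → ℝ × ℝ := fun p =>
    (cCoef b h σp σf τ + dCoef σp σf τ * (p.1 - η + √(σp : ℝ) * p.2),
      cCoef b h σp σf τ + dCoef σp σf τ * (p.1 - η - √(σp : ℝ) * p.2)) with hφ
  have hφm : Measurable φ := by fun_prop
  have hlaw : ((gaussianReal θ σp).prod (gaussianReal 0 1)).map φ = ν.prod ν :=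
    map_pair_eq θ η _ _ σp
  rw [← hlaw] at hE2
  have hF : MemLp (E ∘ φ) 2 ((gaussianReal θ σp).prod (gaussianReal 0 1)) :=
    (memLp_map_measure_iff hEm.aestronglyMeasurable hφm.aemeasurable).1 hE2
  have hT : ∀ x, thresholdEst n b h σp σf γ τ (x - η)
      = ∫ z, (E ∘ φ) (x, z) ∂(gaussianReal 0 1) := by
    intro x
    simp only [thresholdEst, randThresholdEst_eq, E, coe_pairVar]
    rfl
  simp only [hT]
  refine ⟨memLp_integral_prod_left hF, ?_, fun a => ?_⟩
  · rw [← integral_prod _ (hF.integrable one_le_two), ← hlaw,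
      integral_map hφm.aemeasurable hEm.aestronglyMeasurable]
    rfl
  · refine (integral_sq_integral_sub_le hF a).trans (le_of_eq ?_)
    rw [← hlaw, integral_map hφm.aemeasurable
      ((hEm.sub_const a).pow_const 2).aestronglyMeasurable]
    rfl


/-! ### Parameters and moments for one coordinate. -/

theorem shrink_nonneg (σp : ℝ≥0) (τ : ℝ≥0∞) : 0 ≤ shrink σp τ := by
  unfold shrink
  split_ifs
  · exact zero_le_one
  · positivity

theorem shrink_le_one (σp : ℝ≥0) (τ : ℝ≥0∞) : shrink σp τ ≤ 1 := by
  unfold shrink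
  split_ifs
  · exact le_rfl
  · exact div_le_one_of_le₀ (by linarith [σp.coe_nonneg]) (by positivity)

theorem pairVar_le {σp σf : ℝ≥0} (hσf : 0 < σf) (τ : ℝ≥0∞) :
    (pairVar σp σf τ : ℝ) ≤ 2 * (σp / σf) := by
  have h0 := shrink_nonneg σp τ
  have h1 := shrink_le_one σp τ
  have hf : (0 : ℝ) < σf := by exact_mod_cast hσf
  have hp : (0 : ℝ) ≤ σp := σp.coe_nonneg
  have hV : (σf : ℝ) ≤ σf + shrink σp τ ^ 2 * σp := le_add_of_nonneg_right (by positivity)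
  have hd : dCoef σp σf τ ^ 2 ≤ 1 / σf := by
    rw [dCoef, div_pow, Real.sq_sqrt (by linarith)]
    refine div_le_div₀ zero_le_one ?_ hf hV
    nlinarith
  rw [coe_pairVar]
  calc 2 * (σp : ℝ) * dCoef σp σf τ ^ 2 ≤ 2 * σp * (1 / σf) := by gcongr
    _ = _ := by ring

/-- With `t = √(2σp/σf)`, the hypothesis on `γ` gives `γ + t ≤ √2 (γ + √(σp/σf)) ≤ 1/√(2e)`, hence
`(γ + t)² · 2 log n ≤ (log n)/e`. The factor `11/10` in `R` makes `(R - lam)² = 2.42 r log n`, just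
above the required `12/5`, while `R² ≤ 1.21 (log n)/e` stays below `9/20 log n`. The truncation
order suffices because `1.21 e ≤ e²/2`. -/
theorem goodParams {n : ℕ} (hn : 1 ≤ n) {σp σf : ℝ≥0} (hσp : 0 < σp) (hσf : 0 < σf) {γ : ℝ}
    (hγ0 : 0 ≤ γ) (hr : (σp : ℝ) / σf ≤ 1 / (4 * Real.exp 1))
    (hγ : γ ≤ 1 / √(4 * Real.exp 1) - √((σp : ℝ) / σf)) :
    GoodParams n (truncOrder n γ σp σf) (threshold n γ)
      (threshold n γ + 11 / 10 * √(2 * (σp / σf)) * √(2 * Real.log n)) (2 * (σp / σf)) := by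
  have hL : 0 ≤ Real.log n := Real.log_natCast_nonneg n
  have he1 : (2.7 : ℝ) < Real.exp 1 := by linarith [Real.exp_one_gt_d9]
  have he2 : Real.exp 1 < 2.72 := by linarith [Real.exp_one_lt_d9]
  have hρ : (0 : ℝ) < σp / σf := div_pos (by exact_mod_cast hσp) (by exact_mod_cast hσf)
  set ρ2 : ℝ := σp / σf
  set L := Real.log n
  set q := √(2 * L)
  set t := √(2 * ρ2) with ht
  have hq : q ^ 2 = 2 * L := Real.sq_sqrt (by positivity)
  have hq0 : 0 ≤ q := Real.sqrt_nonneg _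
  have ht0 : 0 ≤ t := Real.sqrt_nonneg _
  have ht2 : t ^ 2 = 2 * ρ2 := Real.sq_sqrt (by positivity)
  have hA : (γ + √ρ2) ^ 2 ≤ 1 / (4 * Real.exp 1) := by
    have h1 : γ + √ρ2 ≤ 1 / √(4 * Real.exp 1) := by linarith
    have h2 := pow_le_pow_left₀ (by positivity) h1 2
    rwa [div_pow, Real.sq_sqrt (by positivity), one_pow] at h2
  have hgt : (γ + t) ^ 2 ≤ 1 / (2 * Real.exp 1) := by
    have h1 : γ + t ≤ √2 * (γ + √ρ2) := by
      rw [ht, Real.sqrt_mul zero_le_two, mul_add]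
      have : 1 ≤ √2 := Real.one_le_sqrt.2 one_le_two
      nlinarith
    have h2 := pow_le_pow_left₀ (by positivity) h1 2
    rw [mul_pow, Real.sq_sqrt zero_le_two] at h2
    calc (γ + t) ^ 2 ≤ 2 * (1 / (4 * Real.exp 1)) := by linarith
      _ = _ := by ring
  have hthr : threshold n γ = γ * q := rfl
  have hRle : (threshold n γ + 11 / 10 * t * q) ^ 2 ≤ 121 / 100 * ((γ + t) ^ 2 * (2 * L)) := by
    have h1 : threshold n γ + 11 / 10 * t * q ≤ 11 / 10 * ((γ + t) * q) := by
      rw [hthr]; nlinarith [mul_nonneg hγ0 hq0]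
    have h2 := pow_le_pow_left₀ (by rw [hthr]; positivity) h1 2
    refine h2.trans (le_of_eq ?_)
    rw [mul_pow, mul_pow, hq]; ring
  have hx : (γ + t) ^ 2 * (2 * L) ≤ L / Real.exp 1 := by
    calc (γ + t) ^ 2 * (2 * L) ≤ 1 / (2 * Real.exp 1) * (2 * L) := by gcongr
      _ = _ := by field_simp
  have hK : (truncOrder n γ σp σf : ℝ)
      = 1 + (⌈Real.exp 1 ^ 2 * (γ + t) ^ 2 * (2 * L)⌉₊ : ℝ) := by
    simp [truncOrder, t, ρ2, L]
  have hc1 := Nat.le_ceil (Real.exp 1 ^ 2 * (γ + t) ^ 2 * (2 * L))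
  have hc2 := Nat.ceil_lt_add_one (a := Real.exp 1 ^ 2 * (γ + t) ^ 2 * (2 * L)) (by positivity)
  refine ⟨hn, by simp [truncOrder], by rw [hthr]; positivity,
    le_add_of_nonneg_right (by positivity), ?_, by positivity, ?_, ?_, ?_, ?_⟩
  · have : L / Real.exp 1 ≤ 1 / 2.7 * L := by
      rw [div_le_iff₀ (by positivity)]; nlinarith
    norm_num at this
    linarith
  · have : 1 / (4 * Real.exp 1) ≤ 1 / 10 := by gcongr; linarith
    linarith
  · have : (threshold n γ + 11 / 10 * t * q - threshold n γ) ^ 2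
        = 121 / 100 * (t ^ 2 * q ^ 2) := by ring
    rw [this, ht2, hq]
    nlinarith [mul_nonneg hρ.le hL]
  · rw [hK]
    have h1 : (0 : ℝ) ≤ (γ + t) ^ 2 * (2 * L) := by positivity
    calc Real.exp 1 * (threshold n γ + 11 / 10 * t * q) ^ 2
        ≤ Real.exp 1 * (121 / 100 * ((γ + t) ^ 2 * (2 * L))) := by gcongr
      _ = Real.exp 1 * (121 / 100) * ((γ + t) ^ 2 * (2 * L)) := by ring
      _ ≤ Real.exp 1 ^ 2 / 2 * ((γ + t) ^ 2 * (2 * L)) :=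
        mul_le_mul_of_nonneg_right (by nlinarith) h1
      _ = Real.exp 1 ^ 2 * (γ + t) ^ 2 * (2 * L) / 2 := by ring
      _ ≤ _ := by linarith
  · rw [hK]
    have h1 : Real.exp 1 ^ 2 * (γ + t) ^ 2 * (2 * L) ≤ Real.exp 1 * L := by
      calc Real.exp 1 ^ 2 * (γ + t) ^ 2 * (2 * L)
          = Real.exp 1 ^ 2 * ((γ + t) ^ 2 * (2 * L)) := by ring
        _ ≤ Real.exp 1 ^ 2 * (L / Real.exp 1) := by gcongr
        _ = _ := by field_simp
    nlinarith

/-- The standardized mean, from the predictor. -/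
theorem predictor_standardize (b h : ℝ) {σp σf : ℝ≥0} (hσf : 0 < σf) (η θ : ℝ) (τ : ℝ≥0∞) :
    (shrink σp τ * θ + ((1 - shrink σp τ) * η + √(σf + shrink σp τ * σp) * stdQuantile (ratio b h))
      - θ) / √(σf + σp * shrink σp τ ^ 2) = stdMean b h σp σf η θ τ := by
  have hf : (0 : ℝ) < σf := by exact_mod_cast hσf
  have h0 := shrink_nonneg σp τ
  have hV : (0 : ℝ) < √(σf + shrink σp τ ^ 2 * σp) := Real.sqrt_pos.2 (by positivity)
  rw [stdMean, cCoef, dCoef, Real.sqrt_div (by positivity), mul_comm (σp : ℝ)]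
  field_simp
  ring

/-- The contribution of one coordinate to `ARE - L`. -/
noncomputable def coordDiff (n : ℕ) (b h : ℝ) (σp σf : ℝ≥0) (γ η θ : ℝ) (τ : ℝ≥0∞) (x : ℝ) : ℝ :=
  (b + h) * √(σf + σp * shrink σp τ ^ 2) * thresholdEst n b h σp σf γ τ (x - η)
    - coordLoss b h σf θ (predictor b h σp σf η τ x)

/-- The estimate and the loss have means close to and equal to `k G(w, β)`, respectively, which
bounds the bias. The variance is split into the mean squared error of the estimate and the
fluctuation of the loss. -/
theorem coordDiff_moments {n : ℕ} {b h κ : ℝ} {σp σf : ℝ≥0} {γ lam r : ℝ} {R : ℝ} (η θ : ℝ)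
    (τ : ℝ≥0∞) (hb : 0 < b) (hh : 0 < h) (hσf : 0 < σf) (hlam : threshold n γ = lam)
    (P : GoodParams n (truncOrder n γ σp σf) lam R r) (hv : (pairVar σp σf τ : ℝ) ≤ r)
    (hκ : (b + h) * √(σf + σp * shrink σp τ ^ 2) ≤ κ) :
    MemLp (coordDiff n b h σp σf γ η θ τ) 2 (gaussianReal θ σp)
      ∧ |∫ x, coordDiff n b h σp σf γ η θ τ x ∂(gaussianReal θ σp)|
        ≤ κ * (65 * (1 + Real.log n) ^ 2
          * (Real.exp (-(lam ^ 2 / 8)) + Real.exp (-(Real.log n / 5))))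
      ∧ Var[coordDiff n b h σp σf γ η θ τ; gaussianReal θ σp]
        ≤ 2 * κ ^ 2 * (144 * (1 + Real.log n) ^ 2 * Real.exp (4 / 5 * Real.log n))
          + 2 * ((b + h) ^ 2 * σp) := by
  have hbh : 0 < b + h := by linarith
  have hβ0 : 0 ≤ ratio b h := by unfold ratio; positivity
  have hβ1 : ratio b h ≤ 1 := div_le_one_of_le₀ (by linarith) hbh.le
  subst hlam
  obtain ⟨hT, hTE, hTV⟩ := thresholdEst_moments b h σp σf P.lam_nonneg τ η θ
  have hα0 := shrink_nonneg σp τ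
  have hα1 := shrink_le_one σp τ
  set α := shrink σp τ with hα
  set e := (1 - α) * η + √(σf + α * σp) * stdQuantile (ratio b h) with he
  set w := stdMean b h σp σf η θ τ
  set k := (b + h) * √(σf + σp * α ^ 2)
  have hk : 0 ≤ k := by positivity
  have hpred : ∀ x, predictor b h σp σf η τ x = α * x + e := fun x => by
    rw [predictor, he, add_assoc]
  have hl := memLp_coordLoss_affine hb hh θ α e σp σf
  have hlE : ∫ x, coordLoss b h σf θ (α * x + e) ∂(gaussianReal θ σp)
      = k * G w (ratio b h) := by
    rw [integral_coordLoss_affine hbh θ α e σp hσf]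
    congr 2
    exact predictor_standardize b h hσf η θ τ
  have hlV := integral_coordLoss_affine_sub_sq_le hb hh θ e hα0 hα1 σp σf
  set l0 := coordLoss b h σf θ (α * θ + e)
  have hbias := P.abs_integral_pairEst_sub_le hβ0 hβ1 hv w
  have hmse := P.integral_pairEst_sub_sq_le hβ0 hβ1 hv w
  rw [← hTE] at hbias
  have hmse' := (hTV (G w (ratio b h))).trans hmse
  have hD : coordDiff n b h σp σf γ η θ τ
      = fun x => k * thresholdEst n b h σp σf γ τ (x - η) - coordLoss b h σf θ (α * x + e) := by
    ext x; simp only [coordDiff, hpred]; rfl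
  have hkT : MemLp (fun x => k * thresholdEst n b h σp σf γ τ (x - η)) 2 (gaussianReal θ σp) :=
    hT.const_mul k
  have hmem : MemLp (coordDiff n b h σp σf γ η θ τ) 2 (gaussianReal θ σp) := by
    rw [hD]; exact hkT.sub hl
  refine ⟨hmem, ?_, ?_⟩
  · rw [hD, integral_sub (hkT.integrable one_le_two) (hl.integrable one_le_two),
      integral_const_mul, hlE, ← mul_sub, abs_mul, abs_of_nonneg hk]
    exact mul_le_mul hκ hbias (abs_nonneg _) (hk.trans hκ)
  -- Any centring constant bounds the variance; this one compares the estimate with `G` and the loss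
  -- with its value at the mean of the predictor.
  · set a := k * G w (ratio b h) - l0
    rw [← variance_sub_const hmem.1 a]
    refine (variance_le_expectation_sq (hmem.1.sub aestronglyMeasurable_const)).trans ?_
    have i1 : Integrable (fun x => (thresholdEst n b h σp σf γ τ (x - η)
        - G w (ratio b h)) ^ 2) (gaussianReal θ σp) := (hT.sub (memLp_const _)).integrable_sq
    have i2 : Integrable (fun x => (coordLoss b h σf θ (α * x + e) - l0) ^ 2)
        (gaussianReal θ σp) := (hl.sub (memLp_const _)).integrable_sq
    have i3 : Integrable (fun x => (coordDiff n b h σp σf γ η θ τ x - a) ^ 2)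
        (gaussianReal θ σp) := (hmem.sub (memLp_const _)).integrable_sq
    calc ∫ x, (coordDiff n b h σp σf γ η θ τ x - a) ^ 2 ∂(gaussianReal θ σp)
        ≤ ∫ x, (2 * k ^ 2 * (thresholdEst n b h σp σf γ τ (x - η) - G w (ratio b h)) ^ 2
          + 2 * (coordLoss b h σf θ (α * x + e) - l0) ^ 2) ∂(gaussianReal θ σp) := by
          refine integral_mono i3 ((i1.const_mul _).add (i2.const_mul _)) fun x => ?_
          simp only [hD, a]
          nlinarith [sq_nonneg (k * (thresholdEst n b h σp σf γ τ (x - η) - G w (ratio b h))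
            + (coordLoss b h σf θ (α * x + e) - l0))]
      _ = 2 * k ^ 2 * ∫ x, (thresholdEst n b h σp σf γ τ (x - η) - G w (ratio b h)) ^ 2
            ∂(gaussianReal θ σp)
          + 2 * ∫ x, (coordLoss b h σf θ (α * x + e) - l0) ^ 2 ∂(gaussianReal θ σp) := by
          rw [integral_add (i1.const_mul _) (i2.const_mul _), integral_const_mul,
            integral_const_mul]
      _ ≤ _ := by
          have : k ^ 2 ≤ κ ^ 2 := pow_le_pow_left₀ hk hκ 2
          gcongr

/-! ### Averaging over coordinates and the limit. -/

/-- An average of independent square integrable variables is small in mean when the means and the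
variances are. -/
theorem lintegral_average_le {n : ℕ} (hn : 1 ≤ n) {μ : Fin n → Measure ℝ}
    [∀ i, IsProbabilityMeasure (μ i)] {f : Fin n → ℝ → ℝ} (hf : ∀ i, MemLp (f i) 2 (μ i))
    {A V : ℝ} (hA : ∀ i, |∫ t, f i t ∂(μ i)| ≤ A) (hV : ∀ i, Var[f i; μ i] ≤ V) :
    ∫⁻ x, ‖(n : ℝ)⁻¹ * ∑ i, f i (x i)‖ₑ ∂(Measure.pi μ) ≤ ENNReal.ofReal √(A ^ 2 + V / n) := by
  have hn0 : (0 : ℝ) < n := by exact_mod_cast hn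
  have hfi : ∀ i, MemLp (fun x : Fin n → ℝ => f i (x i)) 2 (Measure.pi μ) := fun i =>
    (hf i).comp_measurePreserving (measurePreserving_eval μ i)
  have hsum : MemLp (fun x : Fin n → ℝ => ∑ i, f i (x i)) 2 (Measure.pi μ) :=
    memLp_finsetSum _ fun i _ => hfi i
  have hD : MemLp (fun x : Fin n → ℝ => (n : ℝ)⁻¹ * ∑ i, f i (x i)) 2 (Measure.pi μ) :=
    hsum.const_mul _
  set D := fun x : Fin n → ℝ => (n : ℝ)⁻¹ * ∑ i, f i (x i) with hDdef
  have hmean : |∫ x, D x ∂(Measure.pi μ)| ≤ A := by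
    rw [integral_const_mul, integral_finsetSum _ fun i _ => (hfi i).integrable one_le_two]
    have h1 : ∀ i, ∫ x : Fin n → ℝ, f i (x i) ∂(Measure.pi μ) = ∫ t, f i t ∂(μ i) := fun i =>
      integral_comp_eval (hf i).1
    simp only [h1]
    rw [abs_mul, abs_of_pos (inv_pos.2 hn0), inv_mul_le_iff₀ hn0]
    refine (Finset.abs_sum_le_sum_abs _ _).trans ((Finset.sum_le_sum fun i _ => hA i).trans ?_)
    simp
  have hvar : Var[D; Measure.pi μ] ≤ V / n := by
    have h1 := variance_sum_pi hf
    have h2 : (∑ i, fun x : Fin n → ℝ => f i (x i)) = fun x => ∑ i, f i (x i) := by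
      ext x; simp
    rw [h2] at h1
    rw [hDdef, variance_const_mul, h1]
    have h3 : ∑ i, Var[f i; μ i] ≤ n * V := by
      refine (Finset.sum_le_sum fun i _ => hV i).trans ?_
      simp
    calc ((n : ℝ)⁻¹) ^ 2 * ∑ i, Var[f i; μ i] ≤ ((n : ℝ)⁻¹) ^ 2 * (n * V) := by gcongr
      _ = V / n := by field_simp
  have hsq : ∫ x, D x ^ 2 ∂(Measure.pi μ) ≤ A ^ 2 + V / n := by
    have h1 := variance_eq_sub hD
    have h2 := sq_le_sq.2 (hmean.trans (le_abs_self A))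
    have h3 : ∫ x, (D ^ 2) x ∂(Measure.pi μ) = ∫ x, D x ^ 2 ∂(Measure.pi μ) := rfl
    rw [h3] at h1
    linarith
  have habs : ∫ x, |D x| ∂(Measure.pi μ) ≤ √(A ^ 2 + V / n) := by
    refine Real.le_sqrt_of_sq_le ?_
    refine (sq_integral_le_integral_sq hD.abs).trans (le_trans (le_of_eq ?_) hsq)
    simp
  have h1 : ∫⁻ x, ‖D x‖ₑ ∂(Measure.pi μ) = ENNReal.ofReal (∫ x, ‖D x‖ ∂(Measure.pi μ)) :=
    (ofReal_integral_norm_eq_lintegral_enorm (hD.integrable one_le_two)).symm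
  rw [h1]
  exact ENNReal.ofReal_le_ofReal habs

/-- Used with `L = log n`, so that `exp(-(a * L))` is `n^(-a)` and any power of the logarithm is
absorbed. -/
theorem tendsto_one_add_pow_mul_exp_neg (k : ℕ) {a : ℝ} (ha : 0 < a) :
    Tendsto (fun L : ℝ => (1 + L) ^ k * Real.exp (-(a * L))) atTop (𝓝 0) := by
  have h1 : Tendsto (fun L : ℝ => a * (1 + L)) atTop atTop :=
    (tendsto_atTop_add_const_left _ 1 tendsto_id).const_mul_atTop ha
  have h2 := ((Real.tendsto_pow_mul_exp_neg_atTop_nhds_zero k).comp h1).const_mul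
    (Real.exp a / a ^ k)
  rw [mul_zero] at h2
  refine h2.congr fun L => ?_
  simp only [Function.comp_apply, mul_pow]
  rw [show -(a * (1 + L)) = -a + -(a * L) by ring, Real.exp_add, Real.exp_neg a]
  field_simp

end PredARE

theorem mainTheorem7 (b h : ℕ → ℝ) (σp σf : ℕ → ℝ≥0) (θ γ : ℕ → ℝ)
    (hb : ∀ i, 0 < b i) (hh : ∀ i, 0 < h i) (hσf : ∀ i, 0 < σf i)
    (hA1 : PredARE.AssumptionA1 b h) (hA2 : PredARE.AssumptionA2 θ)
    (hA3 : PredARE.AssumptionA3 σp σf) (hγ : PredARE.AdmissibleThresholds σp σf γ) :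
    Tendsto
      (fun n : ℕ => ⨆ (τ : ℝ≥0∞) (η : ℝ) (_ : |η| ≤ PredARE.rate n),
        ENNReal.ofReal (PredARE.rate n ^ 4) *
          ∫⁻ x, ‖PredARE.areD n b h σp σf γ η τ x
              - PredARE.avgLoss n b h σf θ
                  (fun i : Fin n => PredARE.predictor (b i) (h i) (σp i) (σf i) η τ (x i))‖ₑ
            ∂(PredARE.pastLaw n σp θ))
      atTop (𝓝 0) := by
  open PredARE in
  obtain ⟨-, -, C, hC⟩ := hA1
  obtain ⟨⟨c, hc, hcr⟩, ⟨Cf, hCf⟩, cp, hcp0, hcp⟩ := hA3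
  obtain ⟨hγ1, γ0, hγ0, hγ2⟩ := hγ
  have hσp : ∀ i, 0 < σp i := fun i => hcp0.trans_le (hcp i)
  have hC0 : 0 < C := by linarith [hC 0, hb 0, hh 0]
  have hpf : ∀ i, (σp i : ℝ) ≤ σf i := by
    intro i
    have hf : (0 : ℝ) < σf i := by exact_mod_cast hσf i
    have h1 : (σp i : ℝ) / σf i ≤ 1 := by
      refine (hcr i).trans (hc.le.trans ?_)
      rw [div_le_one (by positivity)]
      linarith [Real.add_one_le_exp 1]
    rwa [div_le_one hf] at h1
  have hCf' : ∀ i, (σf i : ℝ) ≤ Cf := fun i => by exact_mod_cast hCf i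
  set κ : ℝ := C * √(2 * Cf) with hκdef
  have hκ : ∀ i τ, (b i + h i) * √(σf i + σp i * shrink (σp i) τ ^ 2) ≤ κ := by
    intro i τ
    have h0 := shrink_nonneg (σp i) τ
    have h1 : shrink (σp i) τ ^ 2 ≤ 1 := pow_le_one₀ h0 (shrink_le_one _ _)
    have h2 : (σp i : ℝ) * shrink (σp i) τ ^ 2 ≤ σp i * 1 := by gcongr
    have h3 := hCf' i
    have h4 := hpf i
    exact mul_le_mul (hC i) (Real.sqrt_le_sqrt (by linarith)) (Real.sqrt_nonneg _) hC0.le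
  -- Chosen so that `lam²/8 = γ² (2 log n)/8 ≥ a log n` for every coordinate.
  set a : ℝ := γ0 ^ 2 / 4 with hadef
  have ha : 0 < a := by positivity
  set A : ℝ → ℝ := fun L => κ * (65 * (1 + L) ^ 2 * (Real.exp (-(a * L)) + Real.exp (-(L / 5))))
    with hAdef
  set V : ℝ → ℝ := fun L =>
    2 * κ ^ 2 * (144 * (1 + L) ^ 2 * Real.exp (4 / 5 * L)) + 2 * (C ^ 2 * Cf) with hVdef
  set B : ℝ → ℝ := fun L => (1 + L) ^ 4 * √(A L ^ 2 + V L * Real.exp (-L)) with hBdef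
  have hB : Tendsto B atTop (𝓝 0) := by
    -- The factor `(1 + L)^4` enters the square root as `(1 + L)^8`: squared bias gives the square
    -- of a sixth power, the estimate's variance a tenth power, the loss an eighth.
    have t1 := (((tendsto_one_add_pow_mul_exp_neg 6 ha).add
      (tendsto_one_add_pow_mul_exp_neg 6 (a := 1 / 5) (by norm_num))).const_mul (65 * κ)).pow 2
    have t2 := (tendsto_one_add_pow_mul_exp_neg 10 (a := 1 / 5) (by norm_num)).const_mul
      (288 * κ ^ 2)
    have t3 := (tendsto_one_add_pow_mul_exp_neg 8 (a := 1) one_pos).const_mul (2 * (C ^ 2 * Cf))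
    have t := ((t1.add t2).add t3).sqrt
    simp only [add_zero, mul_zero, ne_eq, OfNat.ofNat_ne_zero, not_false_eq_true, zero_pow,
      Real.sqrt_zero] at t
    refine t.congr' ?_
    filter_upwards [eventually_ge_atTop 0] with L hL
    have h4 : (1 + L) ^ 4 = √((1 + L) ^ 8) := by
      rw [show (1 + L) ^ 8 = ((1 + L) ^ 4) ^ 2 by ring, Real.sqrt_sq (by positivity)]
    rw [hBdef]
    simp only
    rw [h4, ← Real.sqrt_mul (by positivity)]
    congr 1
    have e1 : Real.exp (4 / 5 * L) * Real.exp (-L) = Real.exp (-(1 / 5 * L)) := by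
      rw [← Real.exp_add]; congr 1; ring
    have e2 : Real.exp (-(L / 5)) = Real.exp (-(1 / 5 * L)) := by congr 1; ring
    simp only [hAdef, hVdef, one_mul]
    rw [e2]
    linear_combination (-288 * κ ^ 2 * (1 + L) ^ 10) * e1
  have hlog : Tendsto (fun n : ℕ => Real.log n) atTop atTop :=
    Real.tendsto_log_atTop.comp tendsto_natCast_atTop_atTop
  have hlim : Tendsto (fun n : ℕ => ENNReal.ofReal (B (Real.log n))) atTop (𝓝 0) := by
    simpa using ENNReal.tendsto_ofReal (hB.comp hlog)
  refine tendsto_of_tendsto_of_tendsto_of_le_of_le' tendsto_const_nhds hlim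
    (.of_forall fun n => zero_le) ?_
  -- Taking `log n ≥ 1` makes `log log n` nonnegative, so its fourth power is monotone and `1 + L`
  -- can replace it.
  filter_upwards [hlog.eventually_ge_atTop 1, eventually_ge_atTop 1] with n hL hn
  refine iSup_le fun τ => iSup_le fun η => iSup_le fun _ => ?_
  set L := Real.log n with hLdef
  have hexp : Real.exp L = n := Real.exp_log (by exact_mod_cast hn)
  have hrate0 : 0 ≤ rate n := Real.log_nonneg hL
  have hrate : rate n ≤ 1 + L := by
    have := Real.log_le_sub_one_of_pos (lt_of_lt_of_le one_pos hL)
    change Real.log L ≤ _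
    linarith
  have hmom := fun i : Fin n => coordDiff_moments (n := n) η (θ i) τ (hb i) (hh i) (hσf i) rfl
    (goodParams hn (hσp i) (hσf i) (hγ0.le.trans (hγ2 i)) ((hcr i).trans hc.le) (hγ1 i).le)
    (pairVar_le (hσf i) τ) (hκ i τ)
  have hκ0 : 0 ≤ κ := by positivity
  have havg := lintegral_average_le hn (μ := fun i : Fin n => gaussianReal (θ i) (σp i))
    (fun i => (hmom i).1) (A := A L) (V := V L) (fun i => ?_) (fun i => ?_)
  · have hfun : ∀ x : Fin n → ℝ, areD n b h σp σf γ η τ x - avgLoss n b h σf θ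
        (fun i : Fin n => predictor (b i) (h i) (σp i) (σf i) η τ (x i))
        = (n : ℝ)⁻¹ * ∑ i : Fin n, coordDiff n (b i) (h i) (σp i) (σf i) (γ i) η (θ i) τ (x i) := by
      intro x
      simp only [areD, are, avgLoss, coordDiff, Finset.sum_sub_distrib, mul_sub]
    simp only [hfun, pastLaw]
    refine (mul_le_mul' le_rfl havg).trans ?_
    rw [← ENNReal.ofReal_mul (by positivity)]
    refine ENNReal.ofReal_le_ofReal ?_
    have hVn : V L / n = V L * Real.exp (-L) := by
      rw [Real.exp_neg, hexp, div_eq_mul_inv]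
    rw [hVn]
    exact mul_le_mul_of_nonneg_right (pow_le_pow_left₀ hrate0 hrate 4) (Real.sqrt_nonneg _)
  · refine (hmom i).2.1.trans ?_
    have hlam : a * L ≤ threshold n (γ i) ^ 2 / 8 := by
      have h1 : threshold n (γ i) ^ 2 = γ i ^ 2 * (2 * L) := by
        rw [threshold, mul_pow, Real.sq_sqrt (by linarith)]
      have h2 : γ0 ^ 2 ≤ γ i ^ 2 := pow_le_pow_left₀ hγ0.le (hγ2 i) 2
      rw [h1, hadef]
      nlinarith
    simp only [hAdef]
    gcongr
  · refine (hmom i).2.2.trans ?_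
    have h1 : (b i + h i) ^ 2 ≤ C ^ 2 :=
      pow_le_pow_left₀ (by linarith [hb i, hh i]) (hC i) 2
    have h2 : (σp i : ℝ) ≤ Cf := (hpf i).trans (hCf' i)
    simp only [hVdef]
    gcongr
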